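/- Let $q$ be a prime power, let $V$ be a finite-dimensional vector space over $\mathbb F_q$, and let $W=(V,B)$ be a classical formed space: $B$ is a nondegenerate alternating form, or a nondegenerate Hermitian form (with respect to an involutory automorphism of $\mathbb F_q$), or the polar form $B(u,v)=Q(u+v)-Q(u)-Q(v)$ of a nondegenerate quadratic form $Q$ (so $W$ is one of $Sp(2\omega,q)$, $U(2\omega,\sqrt q)$, $U(2\omega+1,\sqrt q)$, $\Omega(2\omega+1,q)$, $\Omega^{\pm}$). If $q$ is even, a quadratic form $Q$ is called nondegenerate if the radical of $B$ has dimension at most $1$ and $Q(v)\neq0$ for every nonzero $v$ in it. A subspace $U$ is singular if $U\le U^\perp$ (and, in the orthogonal case, $Q|_U=0$, which is automatic for $q$ odd). Let $\omega$ be the Witt index, that is, the largest dimension of a singular subspace, and let $1\le k<\omega$. The polar Grassmann graph $\Gamma=PG_W(k)$ has the singular $k$-subspaces as vertices, $X$ and $Y$ being adjacent if $X+Y$ is a singular $(k+1)$-subspace. Distinct vertices $X,Y$ are called opposite if $X\cap Y=(X+Y)^\perp\cap(X+Y)$. A geodesic from $X$ to $Y$ is a path of length $d(X,Y)$. Let $X\ne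 Y$ be vertices of $\Gamma$ and put $m=k-\dim(X\cap Y)$. (1) If $X,Y$ are not opposite, then $d(X,Y)=m$, and the geodesics from $X$ to $Y$ are exactly the sequences $(X_0,\dots,X_m)$ of the form $$X_i=\langle x_1,\dots,x_{m-i},\,y_{m-i+1},\dots,y_m,\,w_1,\dots,w_{k-m}\rangle\quad(0\le i\le m),\tag{F1}$$ where $w_1,\dots,w_{k-m}$ is a basis of $X\cap Y$ that is extended by $x_1,\dots,x_m$ to a basis of $X$ and by $y_1,\dots,y_m$ to a basis of $Y$, such that (R1) for each $1\le i\le m$, either $B(x_i,y_l)=0$ for all $1\le l\le m$, or there is $i'<i$ with $B(x_i,y_{i'})=1$ and $B(x_i,y_l)=0$ for all $l\ne i'$; and distinct $i$ of the second kind have distinct $i'$. (2) If $X,Y$ are opposite, then $d(X,Y)=m+1$, and the geodesics from $X$ to $Y$ are exactly the sequences $(X,X_0,X_1,\dots,X_m)$ of the form $$X=\langle x_1,\dots,x_m,w_1,\dots,w_{k-m}\rangle,\quad X_i=\langle x_0,\dots,x_{m-i-1},\,y_{m-i+1},\dots,y_m,\,w_1,\dots,w_{k-m}\rangle\quad(0\le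 i\le m),\tag{F2}$$ where $w_1,\dots,w_{k-m}$ is a basis of $X\cap Y$ that is extended by $x_1,\dots,x_m$ to a basis of $X$ and by $y_1,\dots,y_m$ to a basis of $Y$, and $x_0,x_1,\dots,x_m,w_1,\dots,w_{k-m}$ is a basis of a singular $(k+1)$-subspace (namely $X+X_0$), such that (R2) $B(x_i,y_i)=1$ for $1\le i\le m$, and $B(x_i,y_j)=0$ for all $0\le i\le m$, $1\le j\le m$ with $i\ne j$. In particular, $\Gamma$ is connected and its diameter is $k+1$. -/

import Mathlib

open Module

universe u v

/-- A classical formed space on a vector space `V` over `F` (to be used for `F` a finite field and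
`V` finite-dimensional). Over a finite field these are exactly the spaces
`Sp(2ω,q)`, `Ω(2ω+1,q)`, `Ω⁺(2ω,q)`, `Ω⁻(2ω+2,q)`, `U(2ω+1,√q)`, `U(2ω,√q)`.

* `symplectic`: a nondegenerate alternating bilinear form.
* `orthogonal`: a nondegenerate quadratic form. In odd characteristic this is the same as a
  nondegenerate symmetric bilinear form `B`, with `Q v = B v v / 2`. In characteristic two
  nondegeneracy (Mathlib's) allows a one-dimensional radical of the polar form on which `Q` does
  not vanish; this is the case of `Ω(2ω+1,q)`, `q` even.
* `unitary`: a nondegenerate Hermitian form with respect to an involution `σ ≠ id`. -/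
inductive FormedSpace (F : Type u) (V : Type v) [Field F] [AddCommGroup V] [Module F V] :
    Type (max u v) where
  | symplectic (B : LinearMap.BilinForm F V) (alt : LinearMap.IsAlt B)
      (nondeg : LinearMap.Nondegenerate B) : FormedSpace F V
  | orthogonal (Q : QuadraticForm F V) (nondeg : Q.Nondegenerate) : FormedSpace F V
  | unitary (σ : F →+* F) (involutive : ∀ a, σ (σ a) = a) (nontrivial : σ ≠ RingHom.id F)
      (B : V →ₛₗ[σ] V →ₗ[F] F) (herm : LinearMap.IsSymm B)
      (nondeg : LinearMap.Nondegenerate B) : FormedSpace F V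

namespace FormedSpace

variable {F : Type u} {V : Type v} [Field F] [AddCommGroup V] [Module F V]

/-- The reflexive sesquilinear form `B` of a formed space; in the orthogonal case it is the polar
form `B(u,v) = Q(u+v) - Q(u) - Q(v)` of the quadratic form. -/
def form : FormedSpace F V → V → V → F
  | symplectic B _ _, a, b => B a b
  | orthogonal Q _, a, b => QuadraticMap.polar Q a b
  | unitary _ _ _ B _ _, a, b => B a b

theorem form_zero (W : FormedSpace F V) (a : V) : W.form a 0 = 0 := by
  cases W <;> simp [form]

theorem form_add (W : FormedSpace F V) (a b c : V) :
    W.form a (b + c) = W.form a b + W.form a c := by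
  cases W <;> simp [form, QuadraticMap.polar_add_right]

theorem form_smul (W : FormedSpace F V) (r : F) (a b : V) :
    W.form a (r • b) = r * W.form a b := by
  cases W <;> simp [form, QuadraticMap.polar_smul_right]

/-- The subspace `U^⊥` of all vectors orthogonal to `U`. -/
def perp (W : FormedSpace F V) (U : Submodule F V) : Submodule F V where
  carrier := {b | ∀ a ∈ U, W.form a b = 0}
  zero_mem' := fun a _ => W.form_zero a
  add_mem' := fun {b c} hb hc a ha => by rw [form_add, hb a ha, hc a ha, add_zero]
  smul_mem' := fun r b hb a ha => by rw [form_smul, hb a ha, mul_zero]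

/-- In the orthogonal case: the quadratic form vanishes on `U`. -/
def QuadraticVanishes : FormedSpace F V → Submodule F V → Prop
  | symplectic _ _ _, _ => True
  | orthogonal Q _, U => ∀ a ∈ U, Q a = 0
  | unitary _ _ _ _ _ _, _ => True

/-- `U` is singular: `U ≤ U^⊥` and, for orthogonal spaces, the quadratic form vanishes on `U`
(the second condition follows from the first unless the characteristic is two). -/
def IsSingular (W : FormedSpace F V) (U : Submodule F V) : Prop :=
  U ≤ W.perp U ∧ W.QuadraticVanishes U

/-- The Witt index `ω`: the largest dimension of a singular subspace. -/
noncomputable def wittIndex (W : FormedSpace F V) : ℕ :=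
  sSup {d : ℕ | ∃ U : Submodule F V, W.IsSingular U ∧ finrank F U = d}

/-- The singular `k`-subspaces of `W`. -/
def SingularSubspace (W : FormedSpace F V) (k : ℕ) : Type v :=
  {U : Submodule F V // W.IsSingular U ∧ finrank F U = k}

/-- The polar Grassmann graph on the singular `k`-subspaces, for `k` smaller than the Witt index:
two of them are adjacent when their sum is a singular `(k+1)`-subspace. -/
def polarGrassmannGraph (W : FormedSpace F V) (k : ℕ) : SimpleGraph (W.SingularSubspace k) where
  Adj X Y := W.IsSingular (X.1 ⊔ Y.1) ∧ finrank F ↥(X.1 ⊔ Y.1) = k + 1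
  symm := ⟨fun X Y h => by rwa [sup_comm Y.1 X.1]⟩
  loopless := ⟨fun X h => by
    have h1 := h.2
    rw [sup_idem, X.2.2] at h1
    omega⟩

/-- The pair `X`, `Y` is opposite: `X ∩ Y = (X + Y)^⊥ ∩ (X + Y)`. -/
def Opposite (W : FormedSpace F V) (X Y : Submodule F V) : Prop :=
  X ⊓ Y = W.perp (X ⊔ Y) ⊓ (X ⊔ Y)

end FormedSpace

/-- `L 0, …, L n` is a geodesic of length `n` from `X` to `Y`: the sequence of the vertices of a
walk from `X` to `Y` whose length `n` is the distance of `X` and `Y`. -/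
def IsGeodesic {α : Type*} (G : SimpleGraph α) (X Y : α) (n : ℕ) (L : Fin (n + 1) → α) : Prop :=
  ∃ p : G.Walk X Y, p.length = n ∧ n = G.dist X Y ∧ ∀ i : Fin (n + 1), p.getVert i = L i

section Forms

variable {F : Type u} {V : Type v} [Field F] [AddCommGroup V] [Module F V]

/-- The family `e` is a basis of the subspace `U`. -/
def IsBasisOf {ι : Type*} (e : ι → V) (U : Submodule F V) : Prop :=
  LinearIndependent F e ∧ Submodule.span F (Set.range e) = U

/-- The concatenation of the vectors `a i`, `i ∈ s`, and `b j`, `j ∈ t`. -/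
def joinFamily (a : ℕ → V) (s : Set ℕ) (b : ℕ → V) (t : Set ℕ) : s ⊕ t → V :=
  Sum.elim (fun i => a i) (fun j => b j)

open Set

/-- Form (F1). The vectors `w 1, …, w (k-m)` are a basis of `X ∩ Y`; together with `x 1, …, x m`
they are a basis of `X` and together with `y 1, …, y m` a basis of `Y`; and for `0 ≤ i ≤ m`
`L i = ⟨x 1, …, x (m-i), y (m-i+1), …, y m, w 1, …, w (k-m)⟩`.
(Values of `x`, `y`, `w` at other indices play no role.) -/
structure FormF1 (k m : ℕ) (X Y : Submodule F V) (L : Fin (m + 1) → Submodule F V)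
    (x y w : ℕ → V) : Prop where
  basis_inter : IsBasisOf (fun i : Icc 1 (k - m) => w i) (X ⊓ Y)
  basis_left : IsBasisOf (joinFamily x (Icc 1 m) w (Icc 1 (k - m))) X
  basis_right : IsBasisOf (joinFamily y (Icc 1 m) w (Icc 1 (k - m))) Y
  terms : ∀ i : Fin (m + 1), L i = Submodule.span F
    (x '' Icc 1 (m - i) ∪ y '' Icc (m - i + 1) m ∪ w '' Icc 1 (k - m))

/-- Relation (R1). Each `x i` (`1 ≤ i ≤ m`) is orthogonal to all of `y 1, …, y m`, or there is
`i' < i` with `B(x i, y i') = 1` and `x i` orthogonal to all the other `y l`; and these `i'` are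
distinct for distinct `i`. -/
structure RelR1 (W : FormedSpace F V) (m : ℕ) (x y : ℕ → V) : Prop where
  rows : ∀ i ∈ Icc 1 m, (∀ l ∈ Icc 1 m, W.form (x i) (y l) = 0) ∨
    ∃ i' ∈ Icc 1 m, i' < i ∧ W.form (x i) (y i') = 1 ∧
      ∀ l ∈ Icc 1 m, l ≠ i' → W.form (x i) (y l) = 0
  inj : ∀ i ∈ Icc 1 m, ∀ j ∈ Icc 1 m, ∀ l ∈ Icc 1 m,
    W.form (x i) (y l) = 1 → W.form (x j) (y l) = 1 → i = j

/-- Form (F2), for a sequence of `m + 2` subspaces: the first term is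
`X = ⟨x 1, …, x m, w 1, …, w (k-m)⟩` and the term number `i + 1` is
`⟨x 0, …, x (m-i-1), y (m-i+1), …, y m, w 1, …, w (k-m)⟩` for `0 ≤ i ≤ m`. Here
`w 1, …, w (k-m)` is a basis of `X ∩ Y`, completed by `x 1, …, x m` to a basis of `X` and by
`y 1, …, y m` to a basis of `Y`, and `x 0, …, x m, w 1, …, w (k-m)` is a basis of a singular
subspace, the sum of the first two terms. -/
structure FormF2 (W : FormedSpace F V) (k m : ℕ) (X Y : Submodule F V)
    (L : Fin (m + 2) → Submodule F V) (x y w : ℕ → V) : Prop where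
  basis_inter : IsBasisOf (fun i : Icc 1 (k - m) => w i) (X ⊓ Y)
  basis_left : IsBasisOf (joinFamily x (Icc 1 m) w (Icc 1 (k - m))) X
  basis_right : IsBasisOf (joinFamily y (Icc 1 m) w (Icc 1 (k - m))) Y
  first : L 0 = X
  first_sum : ∃ U : Submodule F V, W.IsSingular U ∧
    IsBasisOf (joinFamily x (Icc 0 m) w (Icc 1 (k - m))) U
  terms : ∀ i : Fin (m + 1), L i.succ = Submodule.span F
    (x '' Ico 0 (m - i) ∪ y '' Icc (m - i + 1) m ∪ w '' Icc 1 (k - m))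

/-- Relation (R2): `B(x i, y i) = 1` for `1 ≤ i ≤ m` and `B(x i, y j) = 0` for `i ≠ j`,
`0 ≤ i ≤ m`, `1 ≤ j ≤ m`. -/
structure RelR2 (W : FormedSpace F V) (m : ℕ) (x y : ℕ → V) : Prop where
  diag : ∀ i ∈ Icc 1 m, W.form (x i) (y i) = 1
  off_diag : ∀ i ∈ Icc 0 m, ∀ j ∈ Icc 1 m, i ≠ j → W.form (x i) (y j) = 0

end Forms

/-!
The pairing `X × Y → F` given by the form has the radicals `X ∩ Y^⊥` and `Y ∩ X^⊥`, which have equal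
dimension (`finrank_inf_perp_comm`) and contain `X ∩ Y`; the vertices `X`, `Y` are opposite exactly
when these radicals are equal to `X ∩ Y` (`opposite_iff`).

A step of a walk changes the intersection with a fixed vertex by at most one dimension, so the
distance is at least `m = k - dim (X ∩ Y)`. If the radicals are larger than `X ∩ Y`, then `X` is
adjacent to the sum of a vector of `Y ∩ X^⊥` outside `X` and a hyperplane of `X` that contains the
radical `X ∩ Y^⊥` (any hyperplane containing `X ∩ Y`, if the radical is `X`). This vertex is equal to
`Y` or again not opposite to it, which gives a walk of length `m` by induction
(`exists_walk_of_not_opposite`). If `X`, `Y` are opposite, the second term of a walk of length `m`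
would meet `Y` in a subspace of `X^⊥` larger than `X ∩ Y`, which is impossible
(`lt_length_of_opposite`); but as `X` lies in a larger singular subspace, one step leads to a
non-opposite vertex with the same intersection with `Y` (`exists_walk_of_opposite`).

For a walk `X_0, …, X_m` of length `m` the subspaces `A_i = X_0 ∩ X_i` and `B_i = X_i ∩ X_m` form a
descending and an ascending chain, of steps of dimension one, with `X_i = A_i + B_i`
(`seq_term_eq`), and `A_i` is orthogonal to `B_(i+1)`. Bases adapted to the two chains may be
changed by triangular transformations. By row reduction, as in the Bruhat decomposition, the matrix
of the pairing becomes a partial permutation matrix (`exists_isPartialPermutation`), and the orthogonality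
of the chains makes it strictly triangular; this is `FormF1` with `RelR1` (`exists_formF1_of_seq`).
For opposite vertices and a walk `X, X_0, …, X_m` of length `m + 1` the same reduction is applied to
the chain of the `X ∩ A_i` below `X`. Here the matrix is triangular and invertible, hence the
identity, which is `FormF2` with `RelR2` (`exists_formF2_of_seq`).

For the diameter, nondegeneracy of the form provides a singular subspace paired nondegenerately with
a given one, built up from hyperbolic pairs (`exists_isSingular_inf_perp_eq_bot`).
-/

/-! ### Dimensions of subspaces -/

section Dimensions

variable {F : Type u} {V : Type v} [Field F] [AddCommGroup V] [Module F V]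
  [FiniteDimensional F V]

theorem finrank_sup_span_singleton_of_notMem {U : Submodule F V} {v : V} (hv : v ∉ U) :
    finrank F ↥(U ⊔ F ∙ v) = finrank F U + 1 := by
  have h1 := Submodule.finrank_sup_add_finrank_inf_eq U (F ∙ v)
  have hv0 : v ≠ 0 := fun h => hv (h ▸ U.zero_mem)
  have h2 : U ⊓ (F ∙ v) = ⊥ := by
    rw [eq_bot_iff]
    rintro z ⟨hz, hz'⟩
    obtain ⟨r, rfl⟩ := Submodule.mem_span_singleton.1 hz'
    by_cases hr : r = 0
    · simp [hr]
    · exact absurd ((U.smul_mem_iff hr).1 hz) hv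
  rw [h2, finrank_bot, finrank_span_singleton hv0] at h1
  omega

theorem exists_le_le_finrank_eq {R X : Submodule F V} (hRX : R ≤ X) {n : ℕ}
    (hR : finrank F R ≤ n) (hX : n ≤ finrank F X) :
    ∃ A : Submodule F V, R ≤ A ∧ A ≤ X ∧ finrank F A = n := by
  induction n, hR using Nat.le_induction with
  | base => exact ⟨R, le_rfl, hRX, rfl⟩
  | succ n hn ih =>
    obtain ⟨A, hRA, hAX, hA⟩ := ih (by omega)
    obtain ⟨x, hx, hxA⟩ : ∃ x ∈ X, x ∉ A := by
      by_contra! hcon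
      have := Submodule.finrank_mono (show X ≤ A from hcon)
      omega
    refine ⟨A ⊔ F ∙ x, hRA.trans le_sup_left,
      sup_le hAX ((Submodule.span_singleton_le_iff_mem x X).2 hx), ?_⟩
    rw [finrank_sup_span_singleton_of_notMem hxA, hA]

end Dimensions

/-! ### The form and orthogonal complements -/

namespace FormedSpace

variable {F : Type u} {V : Type v} [Field F] [AddCommGroup V] [Module F V]

/-- The automorphism of `F` with respect to which the form is semilinear in its first argument:
the given involution in the unitary case, the identity otherwise. -/
def conj : FormedSpace F V → F →+* F
  | symplectic _ _ _ => RingHom.id F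
  | orthogonal _ _ => RingHom.id F
  | unitary σ _ _ _ _ _ => σ

theorem conj_conj (W : FormedSpace F V) (a : F) : W.conj (W.conj a) = a := by
  cases W with
  | symplectic B alt nondeg => rfl
  | orthogonal Q nondeg => rfl
  | unitary σ involutive nontrivial B herm nondeg => exact involutive a

theorem form_add_left (W : FormedSpace F V) (a b c : V) :
    W.form (a + b) c = W.form a c + W.form b c := by
  cases W <;> simp [form, QuadraticMap.polar_add_left]

theorem form_smul_left (W : FormedSpace F V) (r : F) (a b : V) :
    W.form (r • a) b = W.conj r * W.form a b := by
  cases W <;> simp [form, conj, QuadraticMap.polar_smul_left]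

theorem form_sub (W : FormedSpace F V) (a b c : V) :
    W.form a (b - c) = W.form a b - W.form a c := by
  rw [sub_eq_add_neg, ← neg_one_smul F c, form_add, form_smul]
  ring

theorem form_sub_left (W : FormedSpace F V) (a b c : V) :
    W.form (a - b) c = W.form a c - W.form b c := by
  rw [sub_eq_add_neg, ← neg_one_smul F b, form_add_left, form_smul_left, map_neg, map_one]
  ring

/-- The form is reflexive. -/
theorem form_eq_zero_symm (W : FormedSpace F V) {a b : V} (h : W.form a b = 0) :
    W.form b a = 0 := by
  cases W with
  | symplectic B alt nondeg => exact alt.isRefl a b h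
  | orthogonal Q nondeg => exact (QuadraticMap.polar_comm Q b a).trans h
  | unitary σ involutive nontrivial B herm nondeg =>
    change B a b = 0 at h
    change B b a = 0
    rw [← herm.eq a b, h, map_zero]

theorem le_perp_symm (W : FormedSpace F V) {X Y : Submodule F V} (h : X ≤ W.perp Y) :
    Y ≤ W.perp X :=
  fun _ hy _ hx => W.form_eq_zero_symm (h hx _ hy)

theorem perp_anti (W : FormedSpace F V) {X Y : Submodule F V} (h : X ≤ Y) :
    W.perp Y ≤ W.perp X :=
  fun _ hv _ hx => hv _ (h hx)

theorem perp_sup (W : FormedSpace F V) (X Y : Submodule F V) :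
    W.perp (X ⊔ Y) = W.perp X ⊓ W.perp Y := by
  refine le_antisymm (le_inf (W.perp_anti le_sup_left) (W.perp_anti le_sup_right)) ?_
  rintro v ⟨hX, hY⟩ a ha
  obtain ⟨x, hx, y, hy, rfl⟩ := Submodule.mem_sup.1 ha
  rw [form_add_left, hX x hx, hY y hy, add_zero]

theorem mem_perp_span_singleton (W : FormedSpace F V) {a b : V} :
    b ∈ W.perp (F ∙ a) ↔ W.form a b = 0 := by
  refine ⟨fun h => h a (Submodule.mem_span_singleton_self a), fun h c hc => ?_⟩
  obtain ⟨r, rfl⟩ := Submodule.mem_span_singleton.1 hc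
  rw [form_smul_left, h, mul_zero]

theorem mem_perp_span (W : FormedSpace F V) {s : Set V} {b : V} :
    b ∈ W.perp (Submodule.span F s) ↔ ∀ a ∈ s, W.form a b = 0 := by
  refine ⟨fun h a ha => h a (Submodule.subset_span ha), fun h => ?_⟩
  have : Submodule.span F s ≤ W.perp (F ∙ b) := Submodule.span_le.2 fun a ha =>
    W.mem_perp_span_singleton.2 (W.form_eq_zero_symm (h a ha))
  exact W.le_perp_symm this (Submodule.mem_span_singleton_self b)

/-! ### Singular subspaces -/

theorem IsSingular.form_eq_zero {W : FormedSpace F V} {U : Submodule F V} (h : W.IsSingular U)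
    {a b : V} (ha : a ∈ U) (hb : b ∈ U) : W.form a b = 0 := h.1 hb a ha

theorem IsSingular.mono {W : FormedSpace F V} {U U' : Submodule F V} (h : W.IsSingular U)
    (hU : U' ≤ U) : W.IsSingular U' := by
  refine ⟨hU.trans (h.1.trans (W.perp_anti hU)), ?_⟩
  have h2 := h.2
  cases W with
  | symplectic B alt nondeg => trivial
  | orthogonal Q nondeg => exact fun a ha => h2 a (hU ha)
  | unitary σ involutive nontrivial B herm nondeg => trivial

/-- The sum of two mutually orthogonal singular subspaces is singular. -/
theorem IsSingular.sup {W : FormedSpace F V} {X Y : Submodule F V} (hX : W.IsSingular X)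
    (hY : W.IsSingular Y) (h : X ≤ W.perp Y) : W.IsSingular (X ⊔ Y) := by
  refine ⟨?_, ?_⟩
  · rw [perp_sup]
    exact sup_le (le_inf hX.1 h) (le_inf (W.le_perp_symm h) hY.1)
  · have hX2 := hX.2
    have hY2 := hY.2
    cases W with
    | symplectic B alt nondeg => trivial
    | orthogonal Q nondeg =>
      intro a ha
      obtain ⟨x, hx, y, hy, rfl⟩ := Submodule.mem_sup.1 ha
      have hp : QuadraticMap.polar Q y x = 0 := h hx y hy
      rw [QuadraticMap.map_add Q, hX2 x hx, hY2 y hy, QuadraticMap.polar_comm, hp]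
      simp
    | unitary σ involutive nontrivial B herm nondeg => trivial

theorem isSingular_bot (W : FormedSpace F V) : W.IsSingular ⊥ := by
  refine ⟨bot_le, ?_⟩
  cases W with
  | symplectic B alt nondeg => trivial
  | orthogonal Q nondeg =>
    intro a ha
    rw [(Submodule.mem_bot F).1 ha, QuadraticMap.map_zero]
  | unitary σ involutive nontrivial B herm nondeg => trivial

/-- A singular vector in the radical of the form is zero. In characteristic two this is what the
nondegeneracy of a quadratic form says about the radical of its polar form. -/
theorem IsSingular.eq_zero_of_forall_form_eq_zero {W : FormedSpace F V} {x : V}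
    (hx : W.IsSingular (F ∙ x)) (h : ∀ v, W.form x v = 0) : x = 0 := by
  have h2 := hx.2
  cases W with
  | symplectic B alt nondeg => exact nondeg.1 x h
  | orthogonal Q nondeg =>
    have : x ∈ Q.radical := ⟨h2 x (Submodule.mem_span_singleton_self x), LinearMap.ext h⟩
    rwa [nondeg.radical_eq_bot, Submodule.mem_bot] at this
  | unitary σ involutive nontrivial B herm nondeg => exact nondeg.1 x h

/-- If `x` is singular and `v` is not orthogonal to `x`, then the line `v + F x` contains a
singular vector. -/
theorem IsSingular.exists_isSingular_add_smul {W : FormedSpace F V} {x v : V}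
    (hx : W.IsSingular (F ∙ x)) (hv : W.form x v ≠ 0) :
    ∃ c : F, W.IsSingular (F ∙ (v + c • x)) := by
  have hx2 := hx.2
  have hxx : W.form x x = 0 := hx.form_eq_zero (Submodule.mem_span_singleton_self x)
    (Submodule.mem_span_singleton_self x)
  have key : ∀ z : V, W.form z z = 0 → F ∙ z ≤ W.perp (F ∙ z) := fun z hz => by
    rw [Submodule.span_singleton_le_iff_mem, mem_perp_span_singleton]
    exact hz
  cases W with
  | symplectic B alt nondeg => exact ⟨0, key _ (alt _), trivial⟩
  | orthogonal Q nondeg =>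
    change QuadraticMap.polar Q x v ≠ 0 at hv
    have hQx : Q x = 0 := hx2 x (Submodule.mem_span_singleton_self x)
    have hQ : Q (v + (-(Q v / QuadraticMap.polar Q x v)) • x) = 0 := by
      rw [QuadraticMap.map_add Q, QuadraticMap.map_smul, hQx, QuadraticMap.polar_smul_right,
        QuadraticMap.polar_comm Q v x]
      simp only [smul_eq_mul, mul_zero, add_zero]
      field_simp
      ring
    refine ⟨-(Q v / QuadraticMap.polar Q x v), key _ ?_, fun a ha => ?_⟩
    · change QuadraticMap.polar Q _ _ = 0
      rw [QuadraticMap.polar_self, hQ, smul_zero]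
    · obtain ⟨r, rfl⟩ := Submodule.mem_span_singleton.1 ha
      rw [QuadraticMap.map_smul, hQ, smul_zero]
  | unitary σ involutive nontrivial B herm nondeg =>
    change B x x = 0 at hxx
    change B x v ≠ 0 at hv
    -- The trace of the involution does not vanish identically.
    obtain ⟨a, ha⟩ : ∃ a, a + σ a ≠ 0 := by
      by_contra! hcon
      refine nontrivial (RingHom.ext fun a => ?_)
      have h1 : (1 : F) + 1 = 0 := by simpa using hcon 1
      have h2 : a + a = 0 := by rw [← two_mul, ← one_add_one_eq_two, h1, zero_mul]
      have h3 := hcon a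
      rw [RingHom.id_apply]
      linear_combination h3 - h2
    have hfix : σ (B v v) = B v v := herm.eq v v
    have hvx : B v x = σ (B x v) := (herm.eq x v).symm
    have hvx0 : B v x ≠ 0 := by
      rw [hvx]
      exact (map_ne_zero σ).2 hv
    have hfa : σ (a + σ a) = a + σ a := by rw [map_add, involutive, add_comm]
    have hsa : σ a + a ≠ 0 := by rwa [add_comm]
    refine ⟨-(B v v * a / (a + σ a)) / B v x, key _ ?_, trivial⟩
    change B _ _ = 0
    simp only [map_add, LinearMap.add_apply, map_smul, LinearMap.map_smulₛₗ, LinearMap.smul_apply,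
      smul_eq_mul, hxx, map_div₀, map_neg, map_mul, hfix, involutive]
    have h4 : σ (B v x) = B x v := herm.eq v x
    rw [h4, add_comm (σ a) a]
    field_simp
    ring

/-! ### Counting dimensions of orthogonal complements -/

section Finite

variable [FiniteDimensional F V]

theorem finrank_le_finrank_inf_perp_singleton (W : FormedSpace F V) (Y : Submodule F V) (x : V) :
    finrank F Y ≤ finrank F ↥(Y ⊓ W.perp (F ∙ x)) + 1 := by
  let f : V →ₗ[F] F :=
    { toFun := W.form x, map_add' := W.form_add x, map_smul' := fun r b => W.form_smul r x b }
  have h1 : W.perp (F ∙ x) = LinearMap.ker f := by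
    ext v
    rw [mem_perp_span_singleton]
    rfl
  have h2 := f.finrank_range_add_finrank_ker
  have h3 : finrank F (LinearMap.range f) ≤ 1 := by
    simpa using Submodule.finrank_le (LinearMap.range f)
  have h4 := Submodule.finrank_sup_add_finrank_inf_eq Y (LinearMap.ker f)
  have h5 := Submodule.finrank_le (Y ⊔ LinearMap.ker f)
  rw [h1]
  omega

/-- `dim Y - dim (Y ∩ X^⊥)` is at most the codimension in `X` of any subspace `R` orthogonal
to `Y`. -/
theorem finrank_add_finrank_le (W : FormedSpace F V) {X R : Submodule F V} (hR : R ≤ X)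
    (Y : Submodule F V) (hRY : R ≤ W.perp Y) :
    finrank F Y + finrank F R ≤ finrank F ↥(Y ⊓ W.perp X) + finrank F X := by
  obtain ⟨n, hn⟩ : ∃ n, finrank F X = finrank F R + n :=
    Nat.exists_eq_add_of_le (Submodule.finrank_mono hR)
  induction n generalizing R Y with
  | zero =>
    obtain rfl : R = X := Submodule.eq_of_le_of_finrank_eq hR (by omega)
    rw [inf_eq_left.2 (W.le_perp_symm hRY)]
  | succ n ih =>
    obtain ⟨x, hx, hxR⟩ : ∃ x ∈ X, x ∉ R := by
      by_contra! hcon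
      have := Submodule.finrank_mono (show X ≤ R from hcon)
      omega
    have h1 := finrank_sup_span_singleton_of_notMem hxR
    have h2 := W.finrank_le_finrank_inf_perp_singleton Y x
    have h3 := ih (R := R ⊔ F ∙ x) (sup_le hR ((Submodule.span_singleton_le_iff_mem x X).2 hx))
      (Y ⊓ W.perp (F ∙ x))
      (sup_le (hRY.trans (W.perp_anti inf_le_left)) (W.le_perp_symm inf_le_right)) (by omega)
    have h4 : finrank F ↥(Y ⊓ W.perp (F ∙ x) ⊓ W.perp X) ≤ finrank F ↥(Y ⊓ W.perp X) :=
      Submodule.finrank_mono (inf_le_inf_right _ inf_le_left)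
    omega

/-- For subspaces of equal dimension the two radicals of the pairing `X × Y → F` have the same
dimension. -/
theorem finrank_inf_perp_comm (W : FormedSpace F V) {X Y : Submodule F V}
    (h : finrank F X = finrank F Y) :
    finrank F ↥(X ⊓ W.perp Y) = finrank F ↥(Y ⊓ W.perp X) := by
  have h1 := W.finrank_add_finrank_le (X := X) (R := X ⊓ W.perp Y) inf_le_left Y inf_le_right
  have h2 := W.finrank_add_finrank_le (X := Y) (R := Y ⊓ W.perp X) inf_le_left X inf_le_right
  omega

theorem inf_perp_le_comm (W : FormedSpace F V) {X Y : Submodule F V} (hX : W.IsSingular X)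
    (h : finrank F X = finrank F Y) (hXY : X ⊓ W.perp Y ≤ Y) :
    Y ⊓ W.perp X ≤ X := by
  have h1 : X ⊓ Y ≤ Y ⊓ W.perp X := le_inf inf_le_right (inf_le_left.trans hX.1)
  have h2 : X ⊓ W.perp Y ≤ X ⊓ Y := le_inf inf_le_left hXY
  have h3 := Submodule.finrank_mono h2
  rw [W.finrank_inf_perp_comm h] at h3
  rw [← Submodule.eq_of_le_of_finrank_le h1 h3]
  exact inf_le_left

/-- Opposite means that the pairing of `X / (X ∩ Y)` with `Y / (X ∩ Y)` is nondegenerate; by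
equality of dimensions it is enough to test this on one side. -/
theorem opposite_iff (W : FormedSpace F V) {X Y : Submodule F V} (hX : W.IsSingular X)
    (hY : W.IsSingular Y) (h : finrank F X = finrank F Y) :
    W.Opposite X Y ↔ X ⊓ W.perp Y ≤ Y := by
  unfold Opposite
  rw [perp_sup]
  constructor
  · intro hop
    have h1 : X ⊓ W.perp Y ≤ X ⊓ Y := by
      rw [hop]
      exact le_inf (le_inf (inf_le_left.trans hX.1) inf_le_right) (inf_le_left.trans le_sup_left)
    exact h1.trans inf_le_right
  · intro hXY
    have hYX := W.inf_perp_le_comm hX h hXY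
    refine le_antisymm ?_ ?_
    · exact le_inf (le_inf (inf_le_left.trans hX.1) (inf_le_right.trans hY.1))
        (inf_le_left.trans le_sup_left)
    · rintro v ⟨⟨hvX, hvY⟩, hv⟩
      obtain ⟨x, hx, y, hy, rfl⟩ := Submodule.mem_sup.1 hv
      have hx' : x ∈ Y := hXY ⟨hx, fun a ha => by
        have := hvY a ha
        rwa [form_add, hY.form_eq_zero ha hy, add_zero] at this⟩
      have hy' : y ∈ X := hYX ⟨hy, fun a ha => by
        have := hvX a ha
        rwa [form_add, hX.form_eq_zero ha hx, zero_add] at this⟩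
      exact ⟨X.add_mem hx hy', Y.add_mem hx' hy⟩

/-- A singular subspace that is not of the largest dimension is contained in a larger one. -/
theorem exists_isSingular_sup_singleton (W : FormedSpace F V) {X : Submodule F V}
    (hX : W.IsSingular X) {n : ℕ} (hn : finrank F X < n)
    (h : ∃ M, W.IsSingular M ∧ finrank F M = n) :
    ∃ z ∉ X, W.IsSingular (X ⊔ F ∙ z) := by
  obtain ⟨M, hM, rfl⟩ := h
  have h1 := W.finrank_add_finrank_le (X := X) (R := X ⊓ M) inf_le_left M
    (inf_le_right.trans hM.1)
  obtain ⟨z, ⟨hzM, hzX⟩, hz⟩ : ∃ z ∈ M ⊓ W.perp X, z ∉ X := by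
    by_contra! hcon
    have h2 : M ⊓ W.perp X ≤ X ⊓ M := le_inf hcon inf_le_left
    have := Submodule.finrank_mono h2
    omega
  refine ⟨z, hz, hX.sup (hM.mono ?_) ?_⟩
  · exact (Submodule.span_singleton_le_iff_mem z M).2 hzM
  · exact W.le_perp_symm ((Submodule.span_singleton_le_iff_mem z _).2 hzX)

theorem exists_isSingular_finrank_eq_wittIndex (W : FormedSpace F V) :
    ∃ M, W.IsSingular M ∧ finrank F M = W.wittIndex := by
  refine Nat.sSup_mem (s := {d | ∃ U : Submodule F V, W.IsSingular U ∧ finrank F U = d})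
    ⟨0, ⊥, W.isSingular_bot, finrank_bot F V⟩ ⟨finrank F V, ?_⟩
  rintro d ⟨U, -, rfl⟩
  exact U.finrank_le

theorem exists_isSingular_finrank_eq (W : FormedSpace F V) {k : ℕ} (hk : k ≤ W.wittIndex) :
    ∃ X, W.IsSingular X ∧ finrank F X = k := by
  induction k with
  | zero => exact ⟨⊥, W.isSingular_bot, finrank_bot F V⟩
  | succ k ih =>
    obtain ⟨X, hX, hXk⟩ := ih (by omega)
    obtain ⟨z, hz, hs⟩ := W.exists_isSingular_sup_singleton hX (by omega)
      W.exists_isSingular_finrank_eq_wittIndex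
    exact ⟨_, hs, by rw [finrank_sup_span_singleton_of_notMem hz, hXk]⟩

/-- Every singular subspace `X` has an opposite disjoint from it: a singular subspace of the same
dimension that is paired nondegenerately with `X`. -/
theorem exists_isSingular_inf_perp_eq_bot (W : FormedSpace F V) {X : Submodule F V}
    (hX : W.IsSingular X) :
    ∃ Y, W.IsSingular Y ∧ finrank F Y = finrank F X ∧ X ⊓ W.perp Y = ⊥ := by
  obtain ⟨n, hn⟩ : ∃ n, finrank F X = n := ⟨_, rfl⟩
  induction n generalizing X with
  | zero =>
    refine ⟨⊥, W.isSingular_bot, by simp [hn], ?_⟩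
    rw [Submodule.finrank_eq_zero.1 hn, bot_inf_eq]
  | succ n ih =>
    obtain ⟨X', hX'X, hX'n⟩ : ∃ X' ≤ X, finrank F X' = n :=
      (exists_le_le_finrank_eq bot_le (by simp) (by omega)).imp fun _ h => h.2
    obtain ⟨Y', hY', hY'n, hXY'⟩ := ih (hX.mono hX'X) hX'n
    have hYX' : Y' ⊓ W.perp X' = ⊥ := by
      rw [← Submodule.finrank_eq_zero, W.finrank_inf_perp_comm hY'n, hXY', finrank_bot]
    -- `x` spans the radical of the pairing of `X` with `Y'`.
    have h1 := W.finrank_add_finrank_le (X := Y') (R := ⊥) bot_le X bot_le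
    obtain ⟨x, ⟨hx, hxY'⟩, hx0⟩ : ∃ x ∈ X ⊓ W.perp Y', x ≠ 0 := by
      refine Submodule.exists_mem_ne_zero_of_ne_bot fun h => ?_
      rw [h] at h1
      simp only [finrank_bot] at h1
      omega
    have hsx : W.IsSingular (F ∙ x) := hX.mono ((Submodule.span_singleton_le_iff_mem x X).2 hx)
    have hxX' : x ∉ X' := fun h => hx0 ((Submodule.mem_bot F).1 (hXY' ▸ ⟨h, hxY'⟩))
    have hxperp : x ∈ W.perp (X' ⊔ Y') := by
      rw [perp_sup]
      exact ⟨fun a ha => hX.form_eq_zero (hX'X ha) hx, hxY'⟩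
    -- The space is the sum of `X' + Y'` and its orthogonal complement.
    have hbot : (X' ⊔ Y') ⊓ W.perp (X' ⊔ Y') = ⊥ := by
      rw [eq_bot_iff, perp_sup]
      rintro v ⟨hv, hvX, hvY⟩
      obtain ⟨a, ha, b, hb, rfl⟩ := Submodule.mem_sup.1 hv
      have ha0 : a ∈ X' ⊓ W.perp Y' := ⟨ha, fun c hc => by
        have := hvY c hc
        rwa [form_add, hY'.form_eq_zero hc hb, add_zero] at this⟩
      have hb0 : b ∈ Y' ⊓ W.perp X' := ⟨hb, fun c hc => by
        have := hvX c hc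
        rwa [form_add, hX.form_eq_zero (hX'X hc) (hX'X ha), zero_add] at this⟩
      rw [hXY', Submodule.mem_bot] at ha0
      rw [hYX', Submodule.mem_bot] at hb0
      simp [ha0, hb0]
    have htop : (X' ⊔ Y') ⊔ W.perp (X' ⊔ Y') = ⊤ := by
      have h2 := W.finrank_add_finrank_le (X := X' ⊔ Y') (R := ⊥) bot_le ⊤ bot_le
      have h3 := Submodule.finrank_sup_add_finrank_inf_eq (X' ⊔ Y') (W.perp (X' ⊔ Y'))
      rw [hbot, finrank_bot] at h3
      rw [top_inf_eq, finrank_bot, finrank_top] at h2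
      refine Submodule.eq_top_of_finrank_eq (le_antisymm (Submodule.finrank_le _) ?_)
      omega
    obtain ⟨v, hv, hxv⟩ : ∃ v ∈ W.perp (X' ⊔ Y'), W.form x v ≠ 0 := by
      by_contra! hcon
      refine hx0 (hsx.eq_zero_of_forall_form_eq_zero fun v => ?_)
      obtain ⟨a, ha, b, hb, rfl⟩ := Submodule.mem_sup.1 (htop ▸ Submodule.mem_top : v ∈ _)
      rw [form_add, W.form_eq_zero_symm (hxperp a ha), hcon b hb, add_zero]
    obtain ⟨c, hc⟩ := hsx.exists_isSingular_add_smul hxv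
    set y := v + c • x with hy
    have hyperp : y ∈ W.perp (X' ⊔ Y') := Submodule.add_mem _ hv (Submodule.smul_mem _ _ hxperp)
    have hxy : W.form x y ≠ 0 := by
      rw [hy, form_add, form_smul, hsx.form_eq_zero (Submodule.mem_span_singleton_self x)
        (Submodule.mem_span_singleton_self x), mul_zero, add_zero]
      exact hxv
    have hyY' : y ∉ Y' := fun h => hxy (W.form_eq_zero_symm (hxY' y h))
    rw [perp_sup] at hyperp
    refine ⟨Y' ⊔ F ∙ y, hY'.sup hc ?_, ?_, ?_⟩
    · exact W.le_perp_symm ((Submodule.span_singleton_le_iff_mem y _).2 hyperp.2)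
    · rw [finrank_sup_span_singleton_of_notMem hyY']
      omega
    · have hXeq : X' ⊔ F ∙ x = X := by
        refine Submodule.eq_of_le_of_finrank_eq
          (sup_le hX'X ((Submodule.span_singleton_le_iff_mem x X).2 hx)) ?_
        rw [finrank_sup_span_singleton_of_notMem hxX']
        omega
      rw [eq_bot_iff, perp_sup]
      rintro u ⟨hu, huY, huy⟩
      obtain ⟨a, ha, b, hb, rfl⟩ := Submodule.mem_sup.1 (hXeq ▸ hu : u ∈ X' ⊔ F ∙ x)
      obtain ⟨r, rfl⟩ := Submodule.mem_span_singleton.1 hb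
      have ha0 : a ∈ X' ⊓ W.perp Y' := ⟨ha, fun c hc => by
        have := huY c hc
        rwa [form_add, form_smul, hxY' c hc, mul_zero, add_zero] at this⟩
      rw [hXY', Submodule.mem_bot] at ha0
      replace huy := W.mem_perp_span_singleton.1 huy
      rw [ha0, zero_add, form_smul] at huy
      have hyx : W.form y x ≠ 0 := fun h => hxy (W.form_eq_zero_symm h)
      have hr : r = 0 := (mul_eq_zero.1 huy).resolve_right hyx
      simp [ha0, hr]

end Finite

end FormedSpace

/-! ### Families adapted to chains of subspaces -/

section AdaptedBases

open Set

variable {F : Type u} {V : Type v} [Field F] [AddCommGroup V] [Module F V]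

theorem span_image_eq_of_forall_mem {a b : ℕ → V} {s : Set ℕ}
    (hab : ∀ i ∈ s, a i ∈ Submodule.span F (b '' s))
    (hba : ∀ i ∈ s, b i ∈ Submodule.span F (a '' s)) :
    Submodule.span F (a '' s) = Submodule.span F (b '' s) := by
  refine le_antisymm (Submodule.span_le.2 ?_) (Submodule.span_le.2 ?_)
  · rintro _ ⟨i, hi, rfl⟩
    exact hab i hi
  · rintro _ ⟨i, hi, rfl⟩
    exact hba i hi

theorem finrank_span_image_le (a : ℕ → V) (s : Finset ℕ) :
    finrank F (Submodule.span F (a '' s)) ≤ s.card := by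
  classical
  rw [← Finset.coe_image]
  exact (finrank_span_finset_le_card _).trans Finset.card_image_le

theorem finrank_span_image_Icc_le (a : ℕ → V) (i j : ℕ) :
    finrank F (Submodule.span F (a '' Icc i j)) ≤ j + 1 - i := by
  have h := finrank_span_image_le (F := F) a (Finset.Icc i j)
  rwa [Finset.coe_Icc, Nat.card_Icc] at h

theorem finrank_span_image_Ico_le (a : ℕ → V) (i j : ℕ) :
    finrank F (Submodule.span F (a '' Ico i j)) ≤ j - i := by
  have h := finrank_span_image_le (F := F) a (Finset.Ico i j)
  rwa [Finset.coe_Ico, Nat.card_Ico] at h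

/-- A family is a basis of `U` as soon as it spans `U` and has `dim U` members. -/
theorem isBasisOf_iff {ι : Type*} [Fintype ι] {e : ι → V} {U : Submodule F V} :
    IsBasisOf e U ↔ Submodule.span F (range e) = U ∧ finrank F U = Fintype.card ι := by
  unfold IsBasisOf
  rw [linearIndependent_iff_card_eq_finrank_span, Set.finrank]
  constructor
  · rintro ⟨h1, h2⟩
    exact ⟨h2, by rw [h1, h2]⟩
  · rintro ⟨h1, h2⟩
    exact ⟨by rw [h1, h2], h1⟩

theorem isBasisOf_Icc_iff {w : ℕ → V} {n : ℕ} {U : Submodule F V} :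
    IsBasisOf (fun i : Icc 1 n => w i) U ↔
      Submodule.span F (w '' Icc 1 n) = U ∧ finrank F U = n := by
  rw [isBasisOf_iff, image_eq_range]
  simp

theorem isBasisOf_joinFamily_iff {x w : ℕ → V} {i m n : ℕ} {U : Submodule F V} :
    IsBasisOf (joinFamily x (Icc i m) w (Icc 1 n)) U ↔
      Submodule.span F (x '' Icc i m) ⊔ Submodule.span F (w '' Icc 1 n) = U ∧
        finrank F U = m + 1 - i + n := by
  rw [isBasisOf_iff, image_eq_range, image_eq_range, ← Submodule.span_union, joinFamily,
    Sum.elim_range]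
  simp

theorem exists_span_image_Icc_eq [FiniteDimensional F V] (U : Submodule F V) :
    ∃ w : ℕ → V, Submodule.span F (w '' Icc 1 (finrank F U)) = U := by
  obtain ⟨f, hf⟩ : ∃ f : Fin (finrank F U) → V, Submodule.span F (range f) = U := by
    refine ⟨fun i => finBasis F U i, ?_⟩
    have h := congrArg (Submodule.map U.subtype) (finBasis F U).span_eq
    rwa [Submodule.map_span, ← range_comp, Submodule.map_top, Submodule.range_subtype] at h
  refine ⟨fun i => if h : i - 1 < finrank F U then f ⟨i - 1, h⟩ else 0, ?_⟩
  refine Eq.trans (congrArg _ ?_) hf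
  ext v
  simp only [mem_image, mem_Icc, mem_range]
  constructor
  · rintro ⟨i, hi, rfl⟩
    exact ⟨⟨i - 1, by omega⟩, by rw [dif_pos]⟩
  · rintro ⟨i, rfl⟩
    exact ⟨i + 1, by omega, by simp⟩

/-- A chain of subspaces growing by one dimension at a time has an adapted family of vectors. -/
theorem exists_sup_span_image_Icc_eq [FiniteDimensional F V] (C : ℕ → Submodule F V) (m : ℕ)
    (hle : ∀ j < m, C j ≤ C (j + 1))
    (hrank : ∀ j < m, finrank F (C (j + 1)) = finrank F (C j) + 1) :
    ∃ x : ℕ → V, ∀ j ≤ m, C j = Submodule.span F (x '' Icc 1 j) ⊔ C 0 := by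
  have hex : ∀ j, ∃ v, j < m → v ∈ C (j + 1) ∧ v ∉ C j := by
    intro j
    by_contra! hcon
    have hjm := (hcon 0).1
    have h1 : C (j + 1) ≤ C j := fun v hv => (hcon v).2 hv
    have := Submodule.finrank_mono h1
    have := hrank j hjm
    omega
  choose z hz using hex
  refine ⟨fun i => z (i - 1), fun j hj => ?_⟩
  induction j with
  | zero => simp
  | succ j ih =>
    have h2 := hz j (by omega)
    have h3 : Icc 1 (j + 1) = insert (j + 1) (Icc 1 j) := by
      ext i
      simp only [mem_Icc, mem_insert_iff]
      omega
    rw [h3, image_insert_eq, Submodule.span_insert, sup_assoc, ← ih (by omega), sup_comm,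
      add_tsub_cancel_right]
    refine (Submodule.eq_of_le_of_finrank_eq (sup_le (hle j (by omega))
      ((Submodule.span_singleton_le_iff_mem _ _).2 h2.1)) ?_).symm
    rw [finrank_sup_span_singleton_of_notMem h2.2, hrank j (by omega)]

/-- The version of `exists_sup_span_image_Icc_eq` in which the vectors are numbered from the top
down. -/
theorem exists_sup_span_image_Icc_eq' [FiniteDimensional F V] (D : ℕ → Submodule F V) (m : ℕ)
    (hle : ∀ j < m, D j ≤ D (j + 1))
    (hrank : ∀ j < m, finrank F (D (j + 1)) = finrank F (D j) + 1) :
    ∃ y : ℕ → V, ∀ j ≤ m, D j = Submodule.span F (y '' Icc (m - j + 1) m) ⊔ D 0 := by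
  obtain ⟨x, hx⟩ := exists_sup_span_image_Icc_eq D m hle hrank
  refine ⟨fun i => x (m + 1 - i), fun j hj => ?_⟩
  rw [hx j hj]
  congr 2
  ext v
  simp only [mem_image, mem_Icc]
  constructor
  · rintro ⟨i, hi, rfl⟩
    exact ⟨m + 1 - i, by omega, by congr 1; omega⟩
  · rintro ⟨i, hi, rfl⟩
    exact ⟨m + 1 - i, by omega, rfl⟩

end AdaptedBases

/-! ### Bruhat normal form of the pairing of two families -/

namespace FormedSpace

open Set

variable {F : Type u} {V : Type v} [Field F] [AddCommGroup V] [Module F V]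

/-- The first `n` rows of the `m`-column matrix `B (x i) (y l)` are those of a partial permutation
matrix: every row has at most one nonzero entry, equal to `1`, and these entries are in different
columns. -/
structure IsPartialPermutation (W : FormedSpace F V) (n m : ℕ) (x y : ℕ → V) : Prop where
  rows : ∀ i ∈ Icc 1 n, (∀ l ∈ Icc 1 m, W.form (x i) (y l) = 0) ∨
    ∃ i' ∈ Icc 1 m, W.form (x i) (y i') = 1 ∧ ∀ l ∈ Icc 1 m, l ≠ i' → W.form (x i) (y l) = 0
  inj : ∀ i ∈ Icc 1 n, ∀ j ∈ Icc 1 n, ∀ l ∈ Icc 1 m,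
    W.form (x i) (y l) = 1 → W.form (x j) (y l) = 1 → i = j

theorem IsPartialPermutation.congr {W : FormedSpace F V} {n m : ℕ} {x y x' y' : ℕ → V}
    (h : W.IsPartialPermutation n m x y)
    (heq : ∀ i ∈ Icc 1 n, ∀ l ∈ Icc 1 m, W.form (x' i) (y' l) = W.form (x i) (y l)) :
    W.IsPartialPermutation n m x' y' := by
  refine ⟨fun i hi => ?_, fun i hi j hj l hl => ?_⟩
  · rcases h.rows i hi with h0 | ⟨i', hi', h1, h0⟩
    · exact .inl fun l hl => by rw [heq i hi l hl, h0 l hl]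
    · exact .inr ⟨i', hi', by rw [heq i hi i' hi', h1],
        fun l hl hne => by rw [heq i hi l hl, h0 l hl hne]⟩
  · rw [heq i hi l hl, heq j hj l hl]
    exact h.inj i hi j hj l hl

/-- An entry of a partial permutation matrix is `0` or `1`. -/
theorem IsPartialPermutation.eq_one_of_ne_zero {W : FormedSpace F V} {n m : ℕ} {x y : ℕ → V}
    (h : W.IsPartialPermutation n m x y) {i l : ℕ} (hi : i ∈ Icc 1 n) (hl : l ∈ Icc 1 m)
    (hne : W.form (x i) (y l) ≠ 0) : W.form (x i) (y l) = 1 := by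
  rcases h.rows i hi with h0 | ⟨i', -, h1, h0⟩
  · exact absurd (h0 l hl) hne
  · by_cases hli : l = i'
    · rw [hli, h1]
    · exact absurd (h0 l hl hli) hne

/-- Subtracting from `z` a combination of the first `j` rows, its entries in the pivot columns of
these rows can be made zero. -/
theorem IsPartialPermutation.exists_clear_pivots {W : FormedSpace F V} {n m : ℕ} {x y : ℕ → V}
    (h : W.IsPartialPermutation n m x y) (z : V) {j : ℕ} (hj : j ≤ n) :
    ∃ s ∈ Submodule.span F (x '' Icc 1 j), ∀ i ∈ Icc 1 j, ∀ l ∈ Icc 1 m,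
      W.form (x i) (y l) = 1 → W.form (z - s) (y l) = 0 := by
  induction j with
  | zero => exact ⟨0, zero_mem _, fun i hi => by simp at hi⟩
  | succ j ih =>
    obtain ⟨s, hs, hsp⟩ := ih (by omega)
    have hmono : Submodule.span F (x '' Icc 1 j) ≤ Submodule.span F (x '' Icc 1 (j + 1)) :=
      Submodule.span_mono (image_mono (Icc_subset_Icc_right (by omega)))
    have hjn : j + 1 ∈ Icc 1 n := ⟨by omega, hj⟩
    rcases h.rows (j + 1) hjn with h0 | ⟨p, hp, h1, h0⟩
    · refine ⟨s, hmono hs, fun i hi l hl hil => ?_⟩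
      rcases eq_or_ne i (j + 1) with rfl | hne
      · rw [h0 l hl] at hil
        exact absurd hil zero_ne_one
      · exact hsp i ⟨hi.1, by have := hi.2; omega⟩ l hl hil
    · refine ⟨s + W.conj (W.form (z - s) (y p)) • x (j + 1),
        add_mem (hmono hs) (Submodule.smul_mem _ _ (Submodule.subset_span
          ⟨j + 1, ⟨by omega, le_rfl⟩, rfl⟩)), fun i hi l hl hil => ?_⟩
      rw [← sub_sub, form_sub_left, form_smul_left, conj_conj]
      rcases eq_or_ne i (j + 1) with rfl | hne
      · have hlp : l = p := by
          by_contra hlp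
          rw [h0 l hl hlp] at hil
          exact absurd hil zero_ne_one
        rw [hlp, h1, mul_one, sub_self]
      · have hlp : l ≠ p := by
          rintro rfl
          exact hne (h.inj i ⟨hi.1, hi.2.trans hj⟩ (j + 1) hjn l hl hil h1)
        rw [hsp i ⟨hi.1, by have := hi.2; omega⟩ l hl hil, h0 l hl hlp, mul_zero, sub_zero]

/-- One step of the row reduction: one more row is brought into normal form, adding to
`x (n + 1)` combinations of the preceding rows, and to each column a multiple of a later one. -/
theorem IsPartialPermutation.exists_succ {W : FormedSpace F V} {n m : ℕ} {x y : ℕ → V}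
    (h : W.IsPartialPermutation n m x y) :
    ∃ x' y' : ℕ → V,
      (∀ j, Submodule.span F (x' '' Icc 1 j) = Submodule.span F (x '' Icc 1 j)) ∧
      (∀ j, 1 ≤ j → Submodule.span F (y' '' Icc j m) = Submodule.span F (y '' Icc j m)) ∧
      W.IsPartialPermutation (n + 1) m x' y' := by
  obtain ⟨s, hs, hsp⟩ := h.exists_clear_pivots (x (n + 1)) le_rfl
  set z := x (n + 1) - s with hz
  -- Row `n + 1` may be replaced by any nonzero multiple of `z`.
  have hspan : ∀ c : F, c ≠ 0 → ∀ j, Submodule.span F (Function.update x (n + 1) (c • z) '' Icc 1 j)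
      = Submodule.span F (x '' Icc 1 j) := by
    intro c hc j
    have himg : Function.update x (n + 1) (c • z) '' Icc 1 n = x '' Icc 1 n :=
      image_congr fun i hi => Function.update_of_ne (by have := hi.2; omega) _ _
    refine span_image_eq_of_forall_mem (fun i hi => ?_) (fun i hi => ?_)
    · rcases eq_or_ne i (n + 1) with rfl | hne
      · rw [Function.update_self]
        refine Submodule.smul_mem _ _ (sub_mem (Submodule.subset_span ⟨_, hi, rfl⟩) ?_)
        exact Submodule.span_mono (image_mono (Icc_subset_Icc_right (by have := hi.2; omega))) hs
      · rw [Function.update_of_ne hne]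
        exact Submodule.subset_span ⟨i, hi, rfl⟩
    · rcases eq_or_ne i (n + 1) with rfl | hne
      · have hx : x (n + 1) = c⁻¹ • Function.update x (n + 1) (c • z) (n + 1) + s := by
          rw [Function.update_self, smul_smul, inv_mul_cancel₀ hc, one_smul, hz, sub_add_cancel]
        rw [hx]
        refine add_mem (Submodule.smul_mem _ _ (Submodule.subset_span ⟨_, hi, rfl⟩)) ?_
        rw [← himg] at hs
        exact Submodule.span_mono (image_mono (Icc_subset_Icc_right (by have := hi.2; omega))) hs
      · refine Submodule.subset_span ⟨i, hi, ?_⟩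
        rw [Function.update_of_ne hne]
  have hup : ∀ (c : F) (i : ℕ), i ∈ Icc 1 n → Function.update x (n + 1) (c • z) i = x i :=
    fun c i hi => Function.update_of_ne (by have := hi.2; omega) _ _
  have hcase : ∀ i ∈ Icc 1 (n + 1), i ∈ Icc 1 n ∨ i = n + 1 := fun i hi => by
    have := hi.1
    have := hi.2
    simp only [mem_Icc]
    omega
  by_cases hrow : ∀ l ∈ Icc 1 m, W.form z (y l) = 0
  · have hzero : ∀ l ∈ Icc 1 m,
        W.form (Function.update x (n + 1) ((1 : F) • z) (n + 1)) (y l) = 0 :=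
      fun l hl => by rw [Function.update_self, one_smul, hrow l hl]
    have h' := h.congr (x' := Function.update x (n + 1) ((1 : F) • z)) (y' := y)
      fun i hi l hl => by rw [hup 1 i hi]
    refine ⟨Function.update x (n + 1) ((1 : F) • z), y, hspan 1 one_ne_zero, fun _ _ => rfl,
      fun i hi => ?_, fun i hi j hj l hl h1 h2 => ?_⟩
    · rcases hcase i hi with hi' | rfl
      · exact h'.rows i hi'
      · exact .inl hzero
    · rcases hcase i hi with hi' | rfl
      · rcases hcase j hj with hj' | rfl
        · exact h'.inj i hi' j hj' l hl h1 h2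
        · rw [hzero l hl] at h2
          exact absurd h2 zero_ne_one
      · rw [hzero l hl] at h1
        exact absurd h1 zero_ne_one
  · -- The pivot is the last nonzero entry, so that only columns before it have to be cleared.
    obtain ⟨p, ⟨hp, hpz⟩, hpmax⟩ : ∃ p, (p ∈ Icc 1 m ∧ W.form z (y p) ≠ 0) ∧
        ∀ l, l ∈ Icc 1 m → W.form z (y l) ≠ 0 → l ≤ p := by
      have hfin : ({l | l ∈ Icc 1 m ∧ W.form z (y l) ≠ 0} : Set ℕ).Finite :=
        (finite_Icc 1 m).subset fun l hl => hl.1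
      push Not at hrow
      obtain ⟨l, hl, hlz⟩ := hrow
      obtain ⟨p, hp, hpm⟩ := hfin.exists_maximalFor id _ ⟨l, hl, hlz⟩
      refine ⟨p, hp, fun l hl hlz => ?_⟩
      rcases le_total l p with hle | hle
      · exact hle
      · exact hpm ⟨hl, hlz⟩ hle
    set c : F := W.conj (W.form z (y p))⁻¹ with hc
    have hc0 : c ≠ 0 := (map_ne_zero W.conj).2 (inv_ne_zero hpz)
    have hcz : ∀ v, W.form (c • z) v = (W.form z (y p))⁻¹ * W.form z v := fun v => by
      rw [form_smul_left, hc, conj_conj]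
    have hczp : W.form (c • z) (y p) = 1 := by rw [hcz, inv_mul_cancel₀ hpz]
    have hczl : ∀ l ∈ Icc 1 m, p < l → W.form (c • z) (y l) = 0 := fun l hl hpl => by
      by_contra hne
      rw [hcz] at hne
      exact absurd (hpmax l hl (right_ne_zero_of_mul hne)) (by omega)
    set y' : ℕ → V := fun l => if l = p then y p else y l - W.form (c • z) (y l) • y p with hy'
    have hy'p : y' p = y p := if_pos rfl
    have hy'l : ∀ l, l ≠ p → y' l = y l - W.form (c • z) (y l) • y p := fun l hl => if_neg hl
    -- Column `p` vanishes in the first `n` rows.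
    have hxp : ∀ i ∈ Icc 1 n, W.form (x i) (y p) = 0 := fun i hi => by
      by_contra hne
      exact hpz (hsp i hi p hp (h.eq_one_of_ne_zero hi hp hne))
    have h' := h.congr (x' := Function.update x (n + 1) (c • z)) (y' := y')
      fun i hi l hl => by
        rw [hup c i hi]
        rcases eq_or_ne l p with rfl | hne
        · rw [hy'p]
        · rw [hy'l l hne, form_sub, form_smul, hxp i hi, mul_zero, sub_zero]
    have hlast : ∀ l ∈ Icc 1 m, l ≠ p →
        W.form (Function.update x (n + 1) (c • z) (n + 1)) (y' l) = 0 := fun l hl hne => by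
      rw [Function.update_self, hy'l l hne, form_sub, form_smul, hczp, mul_one, sub_self]
    have hpcol : ∀ i ∈ Icc 1 n, W.form (Function.update x (n + 1) (c • z) i) (y' p) = 0 :=
      fun i hi => by rw [hup c i hi, hy'p, hxp i hi]
    refine ⟨Function.update x (n + 1) (c • z), y', hspan c hc0, fun j hj => ?_,
      fun i hi => ?_, fun i hi j hj l hl h1 h2 => ?_⟩
    · refine span_image_eq_of_forall_mem (fun l hl => ?_) (fun l hl => ?_)
      · rcases eq_or_ne l p with rfl | hne
        · rw [hy'p]
          exact Submodule.subset_span ⟨l, hl, rfl⟩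
        · rw [hy'l l hne]
          refine sub_mem (Submodule.subset_span ⟨l, hl, rfl⟩) ?_
          rcases lt_or_ge p l with hpl | hlp
          · rw [hczl l ⟨hj.trans hl.1, hl.2⟩ hpl, zero_smul]
            exact zero_mem _
          · exact Submodule.smul_mem _ _ (Submodule.subset_span ⟨p, ⟨hl.1.trans hlp, hp.2⟩, rfl⟩)
      · rcases eq_or_ne l p with rfl | hne
        · rw [← hy'p]
          exact Submodule.subset_span ⟨l, hl, rfl⟩
        · have : y l = y' l + W.form (c • z) (y l) • y' p := by
            rw [hy'p, hy'l l hne, sub_add_cancel]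
          rw [this]
          refine add_mem (Submodule.subset_span ⟨l, hl, rfl⟩) ?_
          rcases lt_or_ge p l with hpl | hlp
          · rw [hczl l ⟨hj.trans hl.1, hl.2⟩ hpl, zero_smul]
            exact zero_mem _
          · exact Submodule.smul_mem _ _ (Submodule.subset_span ⟨p, ⟨hl.1.trans hlp, hp.2⟩, rfl⟩)
    · rcases hcase i hi with hi' | rfl
      · exact h'.rows i hi'
      · exact .inr ⟨p, hp, by rw [Function.update_self, hy'p, hczp], hlast⟩
    · have hlp : ∀ l ∈ Icc 1 m,
          W.form (Function.update x (n + 1) (c • z) (n + 1)) (y' l) = 1 → l = p := by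
        intro l hl hl1
        by_contra hne
        rw [hlast l hl hne] at hl1
        exact zero_ne_one hl1
      rcases hcase i hi with hi' | rfl <;> rcases hcase j hj with hj' | rfl
      · exact h'.inj i hi' j hj' l hl h1 h2
      · rw [hlp l hl h2, hpcol i hi'] at h1
        exact absurd h1 zero_ne_one
      · rw [hlp l hl h1, hpcol j hj'] at h2
        exact absurd h2 zero_ne_one
      · rfl

/-- Bruhat normal form: without changing the spans of the initial segments of `x` and of the final
segments of `y`, the matrix `B (x i) (y l)` can be made a partial permutation matrix. -/
theorem exists_isPartialPermutation (W : FormedSpace F V) (m : ℕ) (x y : ℕ → V) :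
    ∃ x' y' : ℕ → V,
      (∀ j, Submodule.span F (x' '' Icc 1 j) = Submodule.span F (x '' Icc 1 j)) ∧
      (∀ j, 1 ≤ j → Submodule.span F (y' '' Icc j m) = Submodule.span F (y '' Icc j m)) ∧
      W.IsPartialPermutation m m x' y' := by
  suffices H : ∀ n, ∃ x' y' : ℕ → V,
      (∀ j, Submodule.span F (x' '' Icc 1 j) = Submodule.span F (x '' Icc 1 j)) ∧
      (∀ j, 1 ≤ j → Submodule.span F (y' '' Icc j m) = Submodule.span F (y '' Icc j m)) ∧
      W.IsPartialPermutation n m x' y' from H m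
  intro n
  induction n with
  | zero =>
    exact ⟨x, y, fun _ => rfl, fun _ _ => rfl, fun i hi => by simp at hi,
      fun i hi => by simp at hi⟩
  | succ n ih =>
    obtain ⟨x₁, y₁, hx₁, hy₁, h⟩ := ih
    obtain ⟨x₂, y₂, hx₂, hy₂, h'⟩ := h.exists_succ
    exact ⟨x₂, y₂, fun j => (hx₂ j).trans (hx₁ j), fun j hj => (hy₂ j hj).trans (hy₁ j hj), h'⟩

end FormedSpace

/-! ### Walks as sequences of vertices -/

section Walks

variable {α : Type*}

theorem SimpleGraph.exists_walk_getVert_eq {G : SimpleGraph α} (f : ℕ → α) (n : ℕ)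
    (h : ∀ i < n, G.Adj (f i) (f (i + 1))) :
    ∃ p : G.Walk (f 0) (f n), p.length = n ∧ ∀ i ≤ n, p.getVert i = f i := by
  induction n generalizing f with
  | zero => exact ⟨.nil, rfl, fun i hi => by rw [Nat.le_zero.1 hi]; rfl⟩
  | succ n ih =>
    obtain ⟨p, hp, hpv⟩ := ih (fun i => f (i + 1)) fun i hi => h (i + 1) (by omega)
    refine ⟨.cons (h 0 (by omega)) p, by simp [hp], fun i hi => ?_⟩
    cases i with
    | zero => rfl
    | succ i =>
      rw [Walk.getVert_cons_succ]
      exact hpv i (by omega)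

theorem IsGeodesic.exists_seq {G : SimpleGraph α} {X Y : α} {n : ℕ} {L : Fin (n + 1) → α}
    (h : IsGeodesic G X Y n L) :
    ∃ f : ℕ → α, f 0 = X ∧ f n = Y ∧ (∀ i < n, G.Adj (f i) (f (i + 1))) ∧
      ∀ i : Fin (n + 1), f i = L i := by
  obtain ⟨p, hp, -, hL⟩ := h
  refine ⟨p.getVert, p.getVert_zero, ?_, fun i hi => p.adj_getVert_succ (by omega), hL⟩
  rw [← hp, p.getVert_length]

theorem isGeodesic_of_seq {G : SimpleGraph α} {n : ℕ} {f : ℕ → α}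
    (hf : ∀ i < n, G.Adj (f i) (f (i + 1))) (hd : G.dist (f 0) (f n) = n) :
    IsGeodesic G (f 0) (f n) n fun i => f i := by
  obtain ⟨p, hp, hpv⟩ := G.exists_walk_getVert_eq f n hf
  exact ⟨p, hp, hd.symm, fun i => hpv i (by omega)⟩

end Walks

namespace FormedSpace

open Set

variable {F : Type u} {V : Type v} [Field F] [AddCommGroup V] [Module F V]
  {W : FormedSpace F V} {k : ℕ}

/-! ### Walks in the polar Grassmann graph -/

theorem le_perp_of_adj {X Y : W.SingularSubspace k}
    (h : (W.polarGrassmannGraph k).Adj X Y) : X.1 ≤ W.perp Y.1 :=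
  le_sup_left.trans (h.1.1.trans (W.perp_anti le_sup_right))

theorem seq_inf_left_le_perp {f : ℕ → W.SingularSubspace k} {m : ℕ}
    (hf : ∀ i < m, (W.polarGrassmannGraph k).Adj (f i) (f (i + 1))) {i : ℕ} (hi : i < m) :
    (f 0).1 ⊓ (f i).1 ≤ W.perp ((f (i + 1)).1 ⊓ (f m).1) :=
  inf_le_right.trans ((le_perp_of_adj (hf i hi)).trans (W.perp_anti inf_le_left))

variable [FiniteDimensional F V]

theorem finrank_inf_of_adj {X Y : W.SingularSubspace k}
    (h : (W.polarGrassmannGraph k).Adj X Y) : finrank F ↥(X.1 ⊓ Y.1) + 1 = k := by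
  have h1 := Submodule.finrank_sup_add_finrank_inf_eq X.1 Y.1
  rw [h.2, X.2.2, Y.2.2] at h1
  omega

/-- Along a walk the dimension of the intersection drops by at most one at each step. -/
theorem le_finrank_inf_add {f : ℕ → W.SingularSubspace k} {n : ℕ}
    (hf : ∀ i < n, (W.polarGrassmannGraph k).Adj (f i) (f (i + 1))) {i j : ℕ} (hij : i ≤ j)
    (hj : j ≤ n) : k ≤ finrank F ↥((f i).1 ⊓ (f j).1) + (j - i) := by
  induction j, hij using Nat.le_induction with
  | base =>
    have := (f i).2.2
    rw [inf_idem]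
    omega
  | succ j hij ih =>
    have h1 := ih (by omega)
    have h2 := finrank_inf_of_adj (hf j (by omega))
    have h3 := Submodule.finrank_sup_add_finrank_inf_eq ((f i).1 ⊓ (f j).1)
      ((f j).1 ⊓ (f (j + 1)).1)
    have h4 : finrank F ↥((f i).1 ⊓ (f j).1 ⊔ (f j).1 ⊓ (f (j + 1)).1) ≤ k :=
      (Submodule.finrank_mono (sup_le inf_le_right inf_le_left)).trans_eq (f j).2.2
    have h5 : finrank F ↥((f i).1 ⊓ (f j).1 ⊓ ((f j).1 ⊓ (f (j + 1)).1)) ≤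
        finrank F ↥((f i).1 ⊓ (f (j + 1)).1) :=
      Submodule.finrank_mono (le_inf (inf_le_left.trans inf_le_left)
        (inf_le_right.trans inf_le_right))
    omega

theorem le_finrank_inf_add_length {X Y : W.SingularSubspace k}
    (p : (W.polarGrassmannGraph k).Walk X Y) : k ≤ finrank F ↥(X.1 ⊓ Y.1) + p.length := by
  have h := le_finrank_inf_add (f := p.getVert) (n := p.length)
    (fun i hi => p.adj_getVert_succ hi) (Nat.zero_le _) le_rfl
  rwa [p.getVert_zero, p.getVert_length, Nat.sub_zero] at h

/-- A term `Z` of a walk from `X` to `Y` of length `k - dim (X ∩ Y)` is the sum of `X ∩ Z` and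
`Z ∩ Y`, and contains `X ∩ Y`. -/
theorem seq_term_eq {f : ℕ → W.SingularSubspace k} {m : ℕ}
    (hf : ∀ i < m, (W.polarGrassmannGraph k).Adj (f i) (f (i + 1)))
    (hm : finrank F ↥((f 0).1 ⊓ (f m).1) + m = k) {i : ℕ} (hi : i ≤ m) :
    finrank F ↥((f 0).1 ⊓ (f i).1) + i = k ∧ finrank F ↥((f i).1 ⊓ (f m).1) + (m - i) = k ∧
      (f 0).1 ⊓ (f m).1 ≤ (f i).1 ∧ (f 0).1 ⊓ (f i).1 ⊔ (f i).1 ⊓ (f m).1 = (f i).1 := by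
  have h1 := le_finrank_inf_add hf (Nat.zero_le i) hi
  have h2 := le_finrank_inf_add hf hi le_rfl
  have h3 := Submodule.finrank_sup_add_finrank_inf_eq ((f 0).1 ⊓ (f i).1) ((f i).1 ⊓ (f m).1)
  have h4le : (f 0).1 ⊓ (f i).1 ⊔ (f i).1 ⊓ (f m).1 ≤ (f i).1 := sup_le inf_le_right inf_le_left
  have h5le : (f 0).1 ⊓ (f i).1 ⊓ ((f i).1 ⊓ (f m).1) ≤ (f 0).1 ⊓ (f m).1 :=
    le_inf (inf_le_left.trans inf_le_left) (inf_le_right.trans inf_le_right)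
  have h4 := Submodule.finrank_mono h4le
  have h5 := Submodule.finrank_mono h5le
  have h6 := (f i).2.2
  refine ⟨by omega, by omega, ?_, Submodule.eq_of_le_of_finrank_le h4le (by omega)⟩
  rw [← Submodule.eq_of_le_of_finrank_le h5le (by omega)]
  exact inf_le_left.trans inf_le_right

theorem seq_inf_left_anti {f : ℕ → W.SingularSubspace k} {m : ℕ}
    (hf : ∀ i < m, (W.polarGrassmannGraph k).Adj (f i) (f (i + 1)))
    (hm : finrank F ↥((f 0).1 ⊓ (f m).1) + m = k) {i : ℕ} (hi : i < m) :
    (f 0).1 ⊓ (f (i + 1)).1 ≤ (f 0).1 ⊓ (f i).1 :=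
  le_inf inf_le_left (seq_term_eq (fun j hj => hf j (by omega)) (seq_term_eq hf hm hi).1
    (Nat.le_succ i)).2.2.1

theorem seq_inf_right_mono {f : ℕ → W.SingularSubspace k} {m : ℕ}
    (hf : ∀ i < m, (W.polarGrassmannGraph k).Adj (f i) (f (i + 1)))
    (hm : finrank F ↥((f 0).1 ⊓ (f m).1) + m = k) {i : ℕ} (hi : i < m) :
    (f i).1 ⊓ (f m).1 ≤ (f (i + 1)).1 ⊓ (f m).1 := by
  have hmi : i + (m - i) = m := by omega
  have h := (seq_term_eq (f := fun j => f (i + j)) (m := m - i)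
    (fun j hj => hf (i + j) (by omega)) (by
      rw [hmi]
      exact (seq_term_eq hf hm hi.le).2.1) (i := 1) (by omega)).2.2.1
  rw [hmi] at h
  exact le_inf h inf_le_right

theorem seq_inf_left_anti_of_le {f : ℕ → W.SingularSubspace k} {m : ℕ}
    (hf : ∀ i < m, (W.polarGrassmannGraph k).Adj (f i) (f (i + 1)))
    (hm : finrank F ↥((f 0).1 ⊓ (f m).1) + m = k) {i j : ℕ} (hij : i ≤ j) (hj : j ≤ m) :
    (f 0).1 ⊓ (f j).1 ≤ (f 0).1 ⊓ (f i).1 := by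
  induction j, hij using Nat.le_induction with
  | base => exact le_rfl
  | succ j hij ih => exact (seq_inf_left_anti hf hm (by omega)).trans (ih (by omega))

/-- Vectors adapted to a pair of chains of subspaces, modulo their first terms, for which the pairing
is given by a partial permutation matrix. -/
theorem exists_adapted_isPartialPermutation (W : FormedSpace F V) (C D : ℕ → Submodule F V) (m : ℕ)
    (hC : ∀ j < m, C j ≤ C (j + 1)) (hCr : ∀ j < m, finrank F (C (j + 1)) = finrank F (C j) + 1)
    (hD : ∀ j < m, D j ≤ D (j + 1)) (hDr : ∀ j < m, finrank F (D (j + 1)) = finrank F (D j) + 1) :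
    ∃ x y : ℕ → V, (∀ j ≤ m, C j = Submodule.span F (x '' Icc 1 j) ⊔ C 0) ∧
      (∀ j ≤ m, D j = Submodule.span F (y '' Icc (m - j + 1) m) ⊔ D 0) ∧
      W.IsPartialPermutation m m x y := by
  obtain ⟨x, hx⟩ := exists_sup_span_image_Icc_eq C m hC hCr
  obtain ⟨y, hy⟩ := exists_sup_span_image_Icc_eq' D m hD hDr
  obtain ⟨x', y', hx', hy', h⟩ := W.exists_isPartialPermutation m x y
  exact ⟨x', y', fun j hj => by rw [hx j hj, hx'], fun j hj => by rw [hy j hj, hy' _ (by omega)], h⟩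

/-! ### Geodesics between vertices that are not opposite -/

/-- A walk of length `k - dim (X ∩ Y)` has the form `FormF1` with `RelR1`: the terms `Z` are the
sums of the members `X ∩ Z` and `Z ∩ Y` of two chains, and orthogonality of the `i`-th member of the
first chain to the next member of the second makes the partial permutation matrix strictly triangular. -/
theorem exists_formF1_of_seq {f : ℕ → W.SingularSubspace k} {m : ℕ}
    (hf : ∀ i < m, (W.polarGrassmannGraph k).Adj (f i) (f (i + 1)))
    (hm : finrank F ↥((f 0).1 ⊓ (f m).1) + m = k) :
    ∃ x y w : ℕ → V, FormF1 k m (f 0).1 (f m).1 (fun i => (f i).1) x y w ∧ RelR1 W m x y := by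
  obtain ⟨x, y, hx, hy, hP⟩ := W.exists_adapted_isPartialPermutation
    (fun j => (f 0).1 ⊓ (f (m - j)).1) (fun j => (f j).1 ⊓ (f m).1) m
    (fun j hj => by
      have := seq_inf_left_anti hf hm (i := m - (j + 1)) (by omega)
      rwa [show m - (j + 1) + 1 = m - j by omega] at this)
    (fun j hj => by
      have h1 := (seq_term_eq hf hm (i := m - (j + 1)) (by omega)).1
      have h2 := (seq_term_eq hf hm (i := m - j) (by omega)).1
      omega)
    (fun j hj => seq_inf_right_mono hf hm hj)
    (fun j hj => by
      have h1 := (seq_term_eq hf hm (i := j) (by omega)).2.1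
      have h2 := (seq_term_eq hf hm (i := j + 1) (by omega)).2.1
      omega)
  obtain ⟨w, hw⟩ := exists_span_image_Icc_eq ((f 0).1 ⊓ (f m).1)
  rw [show finrank F ↥((f 0).1 ⊓ (f m).1) = k - m by omega] at hw
  simp only [Nat.sub_zero] at hx
  have hxm := hx m le_rfl
  have hym := hy m le_rfl
  rw [Nat.sub_self, inf_idem, ← hw] at hxm
  rw [inf_idem, Nat.sub_self, zero_add, ← hw] at hym
  have hf0 := (f 0).2.2
  have hfm := (f m).2.2
  refine ⟨x, y, w, ⟨?_, ?_, ?_, fun i => ?_⟩, fun i hi => ?_, hP.inj⟩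
  · exact isBasisOf_Icc_iff.2 ⟨hw, by omega⟩
  · exact isBasisOf_joinFamily_iff.2 ⟨hxm.symm, by omega⟩
  · exact isBasisOf_joinFamily_iff.2 ⟨hym.symm, by omega⟩
  · have him : (i : ℕ) ≤ m := by omega
    have h1 := hx (m - i) (by omega)
    rw [show m - (m - (i : ℕ)) = i by omega, ← hw] at h1
    rw [Submodule.span_union, Submodule.span_union, ← (seq_term_eq hf hm him).2.2.2, h1, hy i him,
      ← hw, sup_sup_sup_comm, sup_idem]
  · rcases hP.rows i hi with h0 | ⟨i', hi', h1, h0⟩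
    · exact .inl h0
    · refine .inr ⟨i', hi', ?_, h1, h0⟩
      by_contra! hle
      -- If `i ≤ i'`, then `x i` and `y i'` lie in orthogonal terms of the two chains.
      have hxi : x i ∈ (f 0).1 ⊓ (f (m - i)).1 := by
        rw [hx i hi.2]
        exact Submodule.mem_sup_left (Submodule.subset_span ⟨i, ⟨hi.1, le_rfl⟩, rfl⟩)
      have hyi : y i' ∈ (f (m - i + 1)).1 ⊓ (f m).1 := by
        have := hi.1
        have := hi.2
        rw [hy (m - i + 1) (by omega)]
        exact Submodule.mem_sup_left (Submodule.subset_span ⟨i', ⟨by omega, hi'.2⟩, rfl⟩)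
      have := seq_inf_left_le_perp hf (i := m - i) (by have := hi.1; have := hi.2; omega) hxi _ hyi
      rw [W.form_eq_zero_symm this] at h1
      exact zero_ne_one h1

/-- Vectors of form `FormF1` satisfying `RelR1` describe a walk. -/
theorem exists_seq_of_formF1 {m : ℕ} {X Y : W.SingularSubspace k}
    (hm : finrank F ↥(X.1 ⊓ Y.1) + m = k) {S : Fin (m + 1) → Submodule F V} {x y w : ℕ → V}
    (hF : FormF1 k m X.1 Y.1 S x y w) (hR : RelR1 W m x y) :
    ∃ f : ℕ → W.SingularSubspace k, f 0 = X ∧ f m = Y ∧ (∀ i : Fin (m + 1), (f i).1 = S i) ∧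
      ∀ i < m, (W.polarGrassmannGraph k).Adj (f i) (f (i + 1)) := by
  obtain ⟨hw, hwr⟩ := isBasisOf_Icc_iff.1 hF.basis_inter
  obtain ⟨hX, hXr⟩ := isBasisOf_joinFamily_iff.1 hF.basis_left
  obtain ⟨hY, hYr⟩ := isBasisOf_joinFamily_iff.1 hF.basis_right
  have hS := hF.terms
  set P : ℕ → Submodule F V := fun a => Submodule.span F (x '' Icc 1 a) with hP
  set Q : ℕ → Submodule F V := fun b => Submodule.span F (y '' Icc b m) with hQ
  set U := Submodule.span F (w '' Icc 1 (k - m)) with hU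
  have hPX : ∀ a ≤ m, P a ⊔ U ≤ X.1 := fun a ha => by
    rw [← hX]
    exact sup_le_sup_right (Submodule.span_mono (image_mono (Icc_subset_Icc_right ha))) _
  have hQY : ∀ b, 1 ≤ b → Q b ⊔ U ≤ Y.1 := fun b hb => by
    rw [← hY]
    exact sup_le_sup_right (Submodule.span_mono (image_mono (Icc_subset_Icc_left hb))) _
  have hUX : U ≤ X.1 := hw.trans_le inf_le_left
  have hUY : U ≤ Y.1 := hw.trans_le inf_le_right
  -- The families are independent because they span spaces of the right dimension.
  have hrank : ∀ a b, a ≤ m → 1 ≤ b → b ≤ m + 1 →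
      finrank F ↥(P a ⊔ Q b ⊔ U) = a + (m + 1 - b) + (k - m) := by
    intro a b ha hb hb'
    have h1 : finrank F (P a) ≤ a := by simpa using finrank_span_image_Icc_le (F := F) x 1 a
    have h2 : finrank F (Q b) ≤ m + 1 - b := finrank_span_image_Icc_le y b m
    have h3 := Submodule.finrank_add_le_finrank_add_finrank (P a ⊔ Q b) U
    have h4 := Submodule.finrank_add_le_finrank_add_finrank (P a) (Q b)
    have h5 : finrank F ↥(Submodule.span F (x '' Icc (a + 1) m)) ≤ m - a := by
      simpa using finrank_span_image_Icc_le (F := F) x (a + 1) m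
    have h6 : finrank F ↥(Submodule.span F (y '' Ico 1 b)) ≤ b - 1 :=
      finrank_span_image_Ico_le y 1 b
    have h7 := Submodule.finrank_add_le_finrank_add_finrank (P a ⊔ Q b ⊔ U)
      (Submodule.span F (x '' Icc (a + 1) m) ⊔ Submodule.span F (y '' Ico 1 b))
    have h8 := Submodule.finrank_add_le_finrank_add_finrank
      (Submodule.span F (x '' Icc (a + 1) m)) (Submodule.span F (y '' Ico 1 b))
    have h9 : X.1 ⊔ Y.1 ≤ P a ⊔ Q b ⊔ U ⊔
        (Submodule.span F (x '' Icc (a + 1) m) ⊔ Submodule.span F (y '' Ico 1 b)) := by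
      rw [← hX, ← hY]
      have hxs : x '' Icc 1 m ⊆ x '' Icc 1 a ∪ x '' Icc (a + 1) m := by
        rw [← image_union]
        refine image_mono fun i hi => ?_
        simp only [mem_union, mem_Icc] at hi ⊢
        omega
      have hys : y '' Icc 1 m ⊆ y '' Icc b m ∪ y '' Ico 1 b := by
        rw [← image_union]
        refine image_mono fun i hi => ?_
        simp only [mem_union, mem_Icc, mem_Ico] at hi ⊢
        omega
      have hxs' := Submodule.span_mono (R := F) hxs
      have hys' := Submodule.span_mono (R := F) hys
      rw [Submodule.span_union] at hxs' hys'
      refine sup_le (sup_le (hxs'.trans ?_) ?_) (sup_le (hys'.trans ?_) ?_)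
      · exact sup_le_sup (le_sup_left.trans le_sup_left) le_sup_left
      · exact le_sup_right.trans le_sup_left
      · exact sup_le_sup (le_sup_right.trans le_sup_left) le_sup_right
      · exact le_sup_right.trans le_sup_left
    have h10 := Submodule.finrank_mono h9
    have h11 := Submodule.finrank_sup_add_finrank_inf_eq X.1 Y.1
    rw [hwr, X.2.2, Y.2.2] at h11
    have h12 : finrank F U = k - m := by rw [hw, hwr]
    omega
  have hsing : ∀ a b, a ≤ b → a ≤ m → 1 ≤ b → W.IsSingular (P a ⊔ Q b ⊔ U) := by
    intro a b hab ha hb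
    have h1 : P a ≤ W.perp (Q b) := by
      refine Submodule.span_le.2 ?_
      rintro _ ⟨i, hi, rfl⟩
      refine W.mem_perp_span.2 ?_
      rintro _ ⟨l, hl, rfl⟩
      have hlm : l ∈ Icc 1 m := ⟨hb.trans hl.1, hl.2⟩
      refine W.form_eq_zero_symm ?_
      rcases hR.rows i ⟨hi.1, hi.2.trans ha⟩ with h0 | ⟨i', -, hii, -, h0⟩
      · exact h0 l hlm
      · refine h0 l hlm ?_
        have := hi.2
        have := hl.1
        omega
    rw [sup_assoc]
    refine (X.2.1.mono (le_sup_left.trans (hPX a ha))).sup (Y.2.1.mono (hQY b hb)) ?_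
    rw [perp_sup]
    refine le_inf h1 ((le_sup_left.trans (hPX a ha)).trans (X.2.1.1.trans (W.perp_anti hUX)))
  have hPQ : ∀ i, Submodule.span F
      (x '' Icc 1 (m - i) ∪ y '' Icc (m - i + 1) m ∪ w '' Icc 1 (k - m)) =
        P (m - i) ⊔ Q (m - i + 1) ⊔ U := fun i => by
    rw [Submodule.span_union, Submodule.span_union]
  refine ⟨fun i => ⟨P (m - i) ⊔ Q (m - i + 1) ⊔ U, hsing _ _ (by omega) (by omega) (by omega), ?_⟩,
    ?_, ?_, fun i => ?_, fun i hi => ⟨?_, ?_⟩⟩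
  · rw [hrank _ _ (by omega) (by omega) (by omega)]
    omega
  · refine Subtype.ext ?_
    change P (m - 0) ⊔ Q (m - 0 + 1) ⊔ U = X.1
    have h0 : Q (m + 1) = ⊥ := by simp [hQ]
    rw [Nat.sub_zero, h0, sup_bot_eq]
    exact hX
  · refine Subtype.ext ?_
    change P (m - m) ⊔ Q (m - m + 1) ⊔ U = Y.1
    have h0 : P 0 = ⊥ := by simp [hP]
    rw [Nat.sub_self, h0, bot_sup_eq]
    exact hY
  · rw [hS i, hPQ]
  all_goals
    have hsup : P (m - i) ⊔ Q (m - i + 1) ⊔ U ⊔ (P (m - (i + 1)) ⊔ Q (m - (i + 1) + 1) ⊔ U) =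
        P (m - i) ⊔ Q (m - i) ⊔ U := by
      rw [show m - (i + 1) + 1 = m - i by omega]
      have h1 : P (m - (i + 1)) ≤ P (m - i) :=
        Submodule.span_mono (image_mono (Icc_subset_Icc_right (by omega)))
      have h2 : Q (m - i + 1) ≤ Q (m - i) :=
        Submodule.span_mono (image_mono (Icc_subset_Icc_left (by omega)))
      refine le_antisymm (sup_le (sup_le_sup_right (sup_le_sup_left h2 _) _)
        (sup_le_sup_right (sup_le_sup_right h1 _) _)) ?_
      exact sup_le (sup_le ((le_sup_left.trans le_sup_left).trans le_sup_left)
        ((le_sup_right.trans le_sup_left).trans le_sup_right)) (le_sup_right.trans le_sup_left)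
  · change W.IsSingular
      (P (m - i) ⊔ Q (m - i + 1) ⊔ U ⊔ (P (m - (i + 1)) ⊔ Q (m - (i + 1) + 1) ⊔ U))
    rw [hsup]
    exact hsing _ _ le_rfl (by omega) (by omega)
  · change finrank F
      ↥(P (m - i) ⊔ Q (m - i + 1) ⊔ U ⊔ (P (m - (i + 1)) ⊔ Q (m - (i + 1) + 1) ⊔ U)) = k + 1
    rw [hsup, hrank _ _ (by omega) (by omega) (by omega)]
    omega

/-! ### Existence of short walks -/

/-- The first step of a walk from `X`: a hyperplane `A` of `X` is extended by a vector `z`. -/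
theorem exists_adj_sup_span_singleton {X : W.SingularSubspace k} {A : Submodule F V} (hA : A ≤ X.1)
    (hAr : finrank F A + 1 = k) {z : V} (hz : z ∉ X.1) (hXz : W.IsSingular (X.1 ⊔ F ∙ z)) :
    ∃ X' : W.SingularSubspace k, X'.1 = A ⊔ F ∙ z ∧ (W.polarGrassmannGraph k).Adj X X' := by
  refine ⟨⟨A ⊔ F ∙ z, hXz.mono (sup_le_sup_right hA _), ?_⟩, rfl, ?_, ?_⟩
  · rw [finrank_sup_span_singleton_of_notMem fun h => hz (hA h), hAr]
  all_goals
    have h : X.1 ⊔ (A ⊔ F ∙ z) = X.1 ⊔ F ∙ z := by rw [← sup_assoc, sup_eq_left.2 hA]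
  · change W.IsSingular (X.1 ⊔ (A ⊔ F ∙ z))
    rwa [h]
  · change finrank F ↥(X.1 ⊔ (A ⊔ F ∙ z)) = k + 1
    rw [h, finrank_sup_span_singleton_of_notMem hz, X.2.2]

theorem eq_of_finrank_inf_eq {X Y : W.SingularSubspace k} (h : finrank F ↥(X.1 ⊓ Y.1) = k) :
    X = Y := by
  refine Subtype.ext ?_
  rw [← Submodule.eq_of_le_of_finrank_eq (inf_le_left : X.1 ⊓ Y.1 ≤ X.1) (by rw [h, X.2.2])]
  exact Submodule.eq_of_le_of_finrank_eq inf_le_right (by rw [h, Y.2.2])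

/-- Vertices that are not opposite are joined by a walk each of whose steps increases the
dimension of the intersection with the target. -/
theorem exists_walk_of_not_opposite {m : ℕ} {X Y : W.SingularSubspace k}
    (hm : finrank F ↥(X.1 ⊓ Y.1) + m = k) (h : m ≠ 0 → ¬ X.1 ⊓ W.perp Y.1 ≤ Y.1) :
    ∃ p : (W.polarGrassmannGraph k).Walk X Y, p.length = m := by
  induction m generalizing X with
  | zero =>
    obtain rfl := eq_of_finrank_inf_eq hm
    exact ⟨.nil, rfl⟩
  | succ m ih =>
    have hXY := h m.succ_ne_zero
    obtain ⟨y, ⟨hy, hyX⟩, hyX'⟩ : ∃ y ∈ Y.1 ⊓ W.perp X.1, y ∉ X.1 := by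
      by_contra! hcon
      exact hXY (W.inf_perp_le_comm Y.2.1 (by rw [X.2.2, Y.2.2]) hcon)
    have hXYR : X.1 ⊓ Y.1 ≤ X.1 ⊓ W.perp Y.1 := inf_le_inf_left _ Y.2.1.1
    -- The hyperplane `A` of `X` contains the radical of the pairing if that is not all of `X`.
    obtain ⟨A, hA, hAX, hAr, hAR⟩ : ∃ A : Submodule F V, X.1 ⊓ Y.1 ≤ A ∧ A ≤ X.1 ∧
        finrank F A + 1 = k ∧ (X.1 ⊓ W.perp Y.1 ≤ A ∨ X.1 ≤ W.perp Y.1) := by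
      have hXr := X.2.2
      by_cases hR : X.1 ≤ W.perp Y.1
      · obtain ⟨A, h1, h2, h3⟩ := exists_le_le_finrank_eq (inf_le_left : X.1 ⊓ Y.1 ≤ X.1)
          (n := k - 1) (by omega) (by omega)
        exact ⟨A, h1, h2, by omega, .inr hR⟩
      · have hlt : finrank F ↥(X.1 ⊓ W.perp Y.1) < k := by
          refine (Submodule.finrank_lt_finrank_of_lt
            (lt_of_le_of_ne inf_le_left fun he => hR ?_)).trans_eq hXr
          exact inf_eq_left.1 he
        obtain ⟨A, h1, h2, h3⟩ := exists_le_le_finrank_eq (inf_le_left : X.1 ⊓ W.perp Y.1 ≤ X.1)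
          (n := k - 1) (by omega) (by omega)
        exact ⟨A, hXYR.trans h1, h2, by omega, .inl h1⟩
    have hyY : F ∙ y ≤ Y.1 := (Submodule.span_singleton_le_iff_mem y _).2 hy
    obtain ⟨X', hX', hadj⟩ := exists_adj_sup_span_singleton hAX hAr hyX'
      (X.2.1.sup (Y.2.1.mono hyY)
        (W.le_perp_symm ((Submodule.span_singleton_le_iff_mem y _).2 hyX)))
    have hinf : X'.1 ⊓ Y.1 = X.1 ⊓ Y.1 ⊔ F ∙ y := by
      rw [hX', sup_comm A, sup_inf_assoc_of_le _ hyY, sup_comm]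
      congr 1
      exact le_antisymm (inf_le_inf_right _ hAX) (le_inf hA inf_le_right)
    have hm' : finrank F ↥(X'.1 ⊓ Y.1) + m = k := by
      rw [hinf, finrank_sup_span_singleton_of_notMem fun h => hyX' (inf_le_left (b := Y.1) h)]
      omega
    obtain ⟨p, hp⟩ := ih hm' fun hm0 hle => by
      rcases hAR with hAR | hAR
      · exact hXY ((le_inf (hAR.trans (le_sup_left.trans hX'.ge)) inf_le_right).trans hle)
      · have h1 : X'.1 ≤ W.perp Y.1 := by
          rw [hX']
          exact sup_le (hAX.trans hAR) (hyY.trans Y.2.1.1)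
        rw [inf_eq_left.2 h1] at hle
        rw [inf_eq_left.2 hle, X'.2.2] at hm'
        omega
    exact ⟨.cons hadj p, by simp [hp]⟩

/-- Distinct opposite vertices are joined by a walk whose first step leads to a vertex that is no
longer opposite to the target. -/
theorem exists_walk_of_opposite (hk : k < W.wittIndex) {m : ℕ} (hm0 : m ≠ 0)
    {X Y : W.SingularSubspace k} (hm : finrank F ↥(X.1 ⊓ Y.1) + m = k)
    (h : X.1 ⊓ W.perp Y.1 ≤ Y.1) :
    ∃ p : (W.polarGrassmannGraph k).Walk X Y, p.length = m + 1 := by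
  obtain ⟨z, hz, hXz⟩ := W.exists_isSingular_sup_singleton X.2.1 (by rwa [X.2.2])
    W.exists_isSingular_finrank_eq_wittIndex
  have hYX := W.inf_perp_le_comm X.2.1 (by rw [X.2.2, Y.2.2]) h
  have hr := finrank_sup_span_singleton_of_notMem hz
  set U := X.1 ⊔ F ∙ z with hU
  rw [X.2.2] at hr
  have hUY := W.finrank_add_finrank_le (X := Y.1) (R := X.1 ⊓ Y.1) inf_le_right U
    ((inf_le_left.trans le_sup_left).trans hXz.1)
  rw [Y.2.2] at hUY
  obtain ⟨x, ⟨hxU, hxY⟩, hx⟩ : ∃ x ∈ U ⊓ W.perp Y.1, x ∉ X.1 := by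
    by_contra! hcon
    have h1 : U ⊓ W.perp Y.1 ≤ X.1 ⊓ Y.1 := fun v hv => ⟨hcon v hv, h ⟨hcon v hv, hv.2⟩⟩
    have := Submodule.finrank_mono h1
    omega
  have hXx : W.IsSingular (X.1 ⊔ F ∙ x) := hXz.mono
    (sup_le le_sup_left ((Submodule.span_singleton_le_iff_mem x _).2 hxU))
  have hxY' : x ∉ Y.1 := fun hxY' => hx (hYX ⟨hxY', fun a ha =>
    hXx.form_eq_zero (Submodule.mem_sup_left ha)
      (Submodule.mem_sup_right (Submodule.mem_span_singleton_self x))⟩)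
  obtain ⟨A, hA, hAX, hAr⟩ := exists_le_le_finrank_eq (inf_le_left : X.1 ⊓ Y.1 ≤ X.1)
    (n := k - 1) (by omega) (by rw [X.2.2]; omega)
  obtain ⟨X', hX', hadj⟩ := exists_adj_sup_span_singleton hAX (by omega) hx hXx
  have hinf : X'.1 ⊓ Y.1 = X.1 ⊓ Y.1 := by
    refine le_antisymm (fun v hv => ⟨hYX ⟨hv.2, ?_⟩, hv.2⟩)
      (le_inf (hA.trans (le_sup_left.trans hX'.ge)) inf_le_right)
    exact le_perp_of_adj hadj.symm hv.1
  obtain ⟨p, hp⟩ := exists_walk_of_not_opposite (X := X') (Y := Y) (m := m) (by rw [hinf, hm])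
    fun _ hle => hxY' (hle
      ⟨hX' ▸ Submodule.mem_sup_right (Submodule.mem_span_singleton_self x), hxY⟩)
  exact ⟨.cons hadj p, by simp [hp]⟩

end FormedSpace

namespace FormedSpace

open Set

variable {F : Type u} {V : Type v} [Field F] [AddCommGroup V] [Module F V]
  [FiniteDimensional F V] {W : FormedSpace F V} {k : ℕ}

/-- Opposite vertices are further apart than the dimension of their intersection alone requires. -/
theorem lt_length_of_opposite {m : ℕ} (hm0 : m ≠ 0) {X Y : W.SingularSubspace k}
    (hm : finrank F ↥(X.1 ⊓ Y.1) + m = k) (h : X.1 ⊓ W.perp Y.1 ≤ Y.1)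
    (p : (W.polarGrassmannGraph k).Walk X Y) : m < p.length := by
  have hle := le_finrank_inf_add_length p
  by_contra! hlt
  obtain rfl : p.length = m := by omega
  have hYX := W.inf_perp_le_comm X.2.1 (by rw [X.2.2, Y.2.2]) h
  have hf := fun i (hi : i < p.length) => p.adj_getVert_succ hi
  have h1 := (seq_term_eq hf (by rwa [p.getVert_zero, p.getVert_length]) (i := 1) (by omega)).2.1
  -- The second term of the walk meets `Y` in a subspace orthogonal to `X`.
  have h2 := seq_inf_left_le_perp hf (i := 0) (by omega)
  rw [inf_idem, zero_add] at h2
  have h3 := W.le_perp_symm h2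
  rw [p.getVert_length] at h1 h3
  rw [p.getVert_zero] at h3
  have h4 : (p.getVert 1).1 ⊓ Y.1 ≤ X.1 ⊓ Y.1 :=
    le_inf ((le_inf inf_le_right h3).trans hYX) inf_le_right
  have h5 := Submodule.finrank_mono h4
  omega

/-! ### Geodesics between opposite vertices -/

/-- A walk `X, g 0, …, g m` of length `m + 1` to an opposite vertex has the form `FormF2` with
`RelR2`. The chain `g 0 ∩ g i`, intersected with `X` and continued by `X` itself, is paired
nondegenerately and triangularly with the chain `g i ∩ g m`, so that the partial permutation matrix
is the identity. -/
theorem exists_formF2_of_seq {m : ℕ} (hm0 : m ≠ 0) {X : W.SingularSubspace k}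
    {g : ℕ → W.SingularSubspace k} (h0 : (W.polarGrassmannGraph k).Adj X (g 0))
    (hg : ∀ i < m, (W.polarGrassmannGraph k).Adj (g i) (g (i + 1)))
    (hm : finrank F ↥(X.1 ⊓ (g m).1) + m = k) (hop : X.1 ⊓ W.perp (g m).1 ≤ (g m).1)
    {L : Fin (m + 2) → Submodule F V} (hL0 : L 0 = X.1)
    (hL : ∀ i : Fin (m + 1), L i.succ = (g i).1) :
    ∃ x y w : ℕ → V, FormF2 W k m X.1 (g m).1 L x y w ∧ RelR2 W m x y := by
  have hYX := W.inf_perp_le_comm X.2.1 (by rw [X.2.2, (g m).2.2]) hop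
  have hXr := X.2.2
  have hYr := (g m).2.2
  have h0r := (g 0).2.2
  -- The second term of the walk meets `Y` in `X ∩ Y`.
  have hinf : (g 0).1 ⊓ (g m).1 = X.1 ⊓ (g m).1 := by
    have hle : (g 0).1 ⊓ (g m).1 ≤ X.1 ⊓ (g m).1 :=
      le_inf ((le_inf inf_le_right (inf_le_left.trans (le_perp_of_adj h0.symm))).trans hYX)
        inf_le_right
    have := le_finrank_inf_add hg (Nat.zero_le m) le_rfl
    exact Submodule.eq_of_le_of_finrank_le hle (by omega)
  have hgm : finrank F ↥((g 0).1 ⊓ (g m).1) + m = k := by rw [hinf, hm]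
  set A : ℕ → Submodule F V := fun i => (g 0).1 ⊓ (g i).1 with hA
  have hAr : ∀ i ≤ m, finrank F (A i) + i = k := fun i hi => (seq_term_eq hg hgm hi).1
  have hAm : A m = X.1 ⊓ (g m).1 := hinf
  -- The last member of the chain `A i` outside `Y` provides `x 0`.
  obtain ⟨x₀, hx₀, hx₀X, hx₀Y⟩ : ∃ x₀ ∈ A (m - 1), x₀ ∉ X.1 ∧ x₀ ∈ W.perp (g m).1 := by
    have hperp := seq_inf_left_le_perp hg (i := m - 1) (by omega)
    rw [show m - 1 + 1 = m by omega, inf_idem] at hperp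
    by_contra! hcon
    have h1 : A (m - 1) ≤ X.1 ⊓ (g m).1 := by
      intro v hv
      have hvX : v ∈ X.1 := by
        by_contra hvX
        exact hcon v hv hvX (hperp hv)
      exact ⟨hvX, hop ⟨hvX, hperp hv⟩⟩
    have h2 := Submodule.finrank_mono h1
    have h3 := hAr (m - 1) (by omega)
    omega
  have hx₀A : ∀ i < m, x₀ ∈ A i := fun i hi =>
    seq_inf_left_anti_of_le hg hgm (show i ≤ m - 1 by omega) (by omega) hx₀
  have hAX : ∀ i < m, A i ⊓ X.1 ⊔ F ∙ x₀ = A i ∧ finrank F ↥(A i ⊓ X.1) + 1 + i = k := by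
    intro i hi
    have h1 := Submodule.finrank_sup_add_finrank_inf_eq (A i) X.1
    have h2 : finrank F ↥(A i ⊔ X.1) ≤ k + 1 := by
      rw [← h0.2, sup_comm]
      exact Submodule.finrank_mono (sup_le_sup_left inf_le_left _)
    have h3 := hAr i hi.le
    have h4 : A i ⊓ X.1 ⊔ F ∙ x₀ ≤ A i :=
      sup_le inf_le_left ((Submodule.span_singleton_le_iff_mem _ _).2 (hx₀A i hi))
    have h5 := Submodule.finrank_mono h4
    have h6 : finrank F ↥(A i ⊓ X.1 ⊔ F ∙ x₀) = finrank F ↥(A i ⊓ X.1) + 1 :=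
      finrank_sup_span_singleton_of_notMem fun h => hx₀X (inf_le_right (a := A i) h)
    exact ⟨Submodule.eq_of_le_of_finrank_le h4 (by omega), by omega⟩
  -- The chain in `X`, from `X ∩ Y` up to `X`.
  set C : ℕ → Submodule F V := fun j => if j < m then A (m - 1 - j) ⊓ X.1 else X.1 with hC
  have hClt : ∀ j < m, C j = A (m - 1 - j) ⊓ X.1 := fun j hj => if_pos hj
  have hCm : C m = X.1 := if_neg (lt_irrefl m)
  have hCr : ∀ j ≤ m, finrank F (C j) + m = k + j := by
    intro j hj
    rcases hj.lt_or_eq with hj | rfl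
    · have := (hAX (m - 1 - j) (by omega)).2
      rw [hClt j hj]
      omega
    · rw [hCm, hXr]
  have hC0 : C 0 = X.1 ⊓ (g m).1 := by
    rw [hClt 0 (by omega), Nat.sub_zero]
    have := (hAX (m - 1) (by omega)).2
    refine (Submodule.eq_of_le_of_finrank_le ?_ (by omega)).symm
    refine le_inf ?_ inf_le_left
    rw [← hAm]
    exact seq_inf_left_anti_of_le hg hgm (by omega) le_rfl
  have hCmono : ∀ j < m, C j ≤ C (j + 1) := by
    intro j hj
    rw [hClt j hj]
    rcases (show j + 1 ≤ m from hj).lt_or_eq with hj' | hj'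
    · rw [hClt _ hj']
      exact inf_le_inf_right _ (seq_inf_left_anti_of_le hg hgm (by omega) (by omega))
    · rw [hj', hCm]
      exact inf_le_right
  obtain ⟨x', y, hx', hy, hP⟩ := W.exists_adapted_isPartialPermutation C
    (fun j => (g j).1 ⊓ (g m).1) m hCmono
    (fun j hj => by
      have h1 := hCr j hj.le
      have h2 := hCr (j + 1) hj
      omega)
    (fun j hj => seq_inf_right_mono hg hgm hj)
    (fun j hj => by
      have h1 := (seq_term_eq hg hgm (i := j) (by omega)).2.1
      have h2 := (seq_term_eq hg hgm (i := j + 1) (by omega)).2.1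
      omega)
  obtain ⟨w, hw⟩ := exists_span_image_Icc_eq (X.1 ⊓ (g m).1)
  rw [show finrank F ↥(X.1 ⊓ (g m).1) = k - m by omega] at hw
  rw [hC0, ← hw] at hx'
  rw [hinf, ← hw] at hy
  set x : ℕ → V := Function.update x' 0 x₀ with hxdef
  have hxx' : ∀ i, i ≠ 0 → x i = x' i := fun i hi => Function.update_of_ne hi _ _
  have hx0 : x 0 = x₀ := Function.update_self _ _ _
  have himg : ∀ j, x '' Icc 1 j = x' '' Icc 1 j := fun j =>
    image_congr fun i hi => hxx' i (by have := hi.1; omega)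
  have hins : ∀ j, x '' Ico 0 (j + 1) = insert x₀ (x' '' Icc 1 j) := fun j => by
    rw [← himg, ← hx0, ← image_insert_eq]
    congr 1
    ext i
    simp only [mem_Ico, mem_insert_iff, mem_Icc]
    omega
  have hym := hy m le_rfl
  rw [inf_idem, Nat.sub_self, zero_add] at hym
  have hxm := hx' m le_rfl
  rw [hCm] at hxm
  have hxC : ∀ i ∈ Icc 1 m, x' i ∈ C i := fun i hi => by
    rw [hx' i hi.2]
    exact Submodule.mem_sup_left (Submodule.subset_span ⟨i, ⟨hi.1, le_rfl⟩, rfl⟩)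
  have hyY : ∀ l ∈ Icc 1 m, y l ∈ (g m).1 := fun l hl => by
    rw [hym]
    exact Submodule.mem_sup_left (Submodule.subset_span ⟨l, hl, rfl⟩)
  -- The matrix of the pairing is lower triangular and has no zero row.
  have hpiv : ∀ i ∈ Icc 1 m, ∃ i' ∈ Icc 1 m, i' ≤ i ∧ W.form (x' i) (y i') = 1 ∧
      ∀ l ∈ Icc 1 m, l ≠ i' → W.form (x' i) (y l) = 0 := by
    intro i hi
    have hi1 := hi.1
    have hi2 := hi.2
    rcases hP.rows i hi with hz | ⟨i', hi', h1, hz⟩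
    · exfalso
      have hxX : x' i ∈ X.1 := by
        rw [hxm]
        exact Submodule.mem_sup_left (Submodule.subset_span ⟨i, hi, rfl⟩)
      have hxY : x' i ∈ W.perp (g m).1 := by
        rw [hym, perp_sup, hw]
        refine ⟨W.mem_perp_span.2 ?_, fun a ha => X.2.1.form_eq_zero ha.1 hxX⟩
        rintro _ ⟨l, hl, rfl⟩
        exact W.form_eq_zero_symm (hz l hl)
      have hxW : x' i ∈ X.1 ⊓ (g m).1 := ⟨hxX, hop ⟨hxX, hxY⟩⟩
      have hle : C i ≤ C (i - 1) := by
        rw [hx' i hi2, hx' (i - 1) (by omega)]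
        refine sup_le (Submodule.span_le.2 ?_) le_sup_right
        rintro _ ⟨j, hj, rfl⟩
        have hj1 := hj.1
        rcases hj.2.lt_or_eq with hji | rfl
        · exact Submodule.mem_sup_left (Submodule.subset_span ⟨j, ⟨hj1, by omega⟩, rfl⟩)
        · exact Submodule.mem_sup_right (hw ▸ hxW)
      have h1 := Submodule.finrank_mono hle
      have h2 := hCr i hi2
      have h3 := hCr (i - 1) (by omega)
      omega
    · refine ⟨i', hi', ?_, h1, hz⟩
      by_contra! hlt
      have hi'2 := hi'.2
      have hxi := hxC i hi
      rw [hClt i (by omega)] at hxi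
      have hyi : y i' ∈ (g (m - 1 - i + 1)).1 ⊓ (g m).1 := by
        rw [hy (m - 1 - i + 1) (by omega)]
        exact Submodule.mem_sup_left (Submodule.subset_span ⟨i', ⟨by omega, hi'2⟩, rfl⟩)
      have := seq_inf_left_le_perp hg (i := m - 1 - i) (by omega) hxi.1 _ hyi
      rw [W.form_eq_zero_symm this] at h1
      exact zero_ne_one h1
  -- A lower triangular permutation matrix is the identity.
  have hdiag : ∀ i, i ∈ Icc 1 m → W.form (x' i) (y i) = 1 := by
    intro i
    induction i using Nat.strong_induction_on with
    | _ i ih =>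
      intro hi
      obtain ⟨i', hi', hle, h1, -⟩ := hpiv i hi
      rcases hle.lt_or_eq with hlt | rfl
      · exact absurd (hP.inj i' hi' i hi i' hi' (ih i' hlt hi') h1) hlt.ne
      · exact h1
  have hU : Submodule.span F (x '' Icc 0 m) ⊔ Submodule.span F (w '' Icc 1 (k - m)) =
      X.1 ⊔ (g 0).1 := by
    have hIcc : Icc 0 m = Ico 0 (m + 1) := by
      ext i
      simp only [mem_Icc, mem_Ico]
      omega
    rw [hIcc, hins, Submodule.span_insert, sup_assoc, ← hxm, sup_comm]
    refine Submodule.eq_of_le_of_finrank_eq (sup_le_sup_left ?_ _) ?_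
    · exact (Submodule.span_singleton_le_iff_mem _ _).2 hx₀.1
    · rw [finrank_sup_span_singleton_of_notMem hx₀X, h0.2, hXr]
  refine ⟨x, y, w, ⟨?_, ?_, ?_, hL0, ⟨X.1 ⊔ (g 0).1, h0.1, ?_⟩, fun i => ?_⟩,
    fun i hi => ?_, fun i hi l hl hil => ?_⟩
  · exact isBasisOf_Icc_iff.2 ⟨hw, by omega⟩
  · exact isBasisOf_joinFamily_iff.2 ⟨by rw [himg, ← hxm], by omega⟩
  · exact isBasisOf_joinFamily_iff.2 ⟨hym.symm, by omega⟩
  · exact isBasisOf_joinFamily_iff.2 ⟨hU, by rw [h0.2]; omega⟩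
  · have him : (i : ℕ) ≤ m := by omega
    have hterm := (seq_term_eq hg hgm him).2.2.2
    rw [Submodule.span_union, Submodule.span_union, hL i, ← hterm, hy i him]
    rcases him.lt_or_eq with hlt | heq
    · have h1 := (hAX i hlt).1
      have h2 := hClt (m - 1 - i) (by omega)
      rw [show m - 1 - (m - 1 - (i : ℕ)) = i by omega, hx' _ (by omega)] at h2
      rw [← h2] at h1
      rw [show (g 0).1 ⊓ (g i).1 = A i from rfl, ← h1, show m - (i : ℕ) = m - 1 - i + 1 by omega,
        hins, Submodule.span_insert]
      simp only [sup_assoc, sup_left_comm, sup_comm, sup_left_idem]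
    · rw [heq, hinf, ← hw, Nat.sub_self]
      simp only [Ico_self, image_empty, Submodule.span_empty, bot_sup_eq]
      rw [sup_comm, sup_assoc, sup_idem]
  · rw [hxx' i (by have := hi.1; omega), hdiag i hi]
  · rcases Nat.eq_zero_or_pos i with rfl | hpos
    · rw [hx0]
      exact W.form_eq_zero_symm (hx₀Y _ (hyY l hl))
    · rw [hxx' i (by omega)]
      have hi' : i ∈ Icc 1 m := ⟨hpos, hi.2⟩
      obtain ⟨i', hi'', -, -, hz⟩ := hpiv i hi'
      refine hz l hl ?_
      rintro rfl
      by_cases hil' : i = l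
      · exact hil hil'
      · have h1 := hdiag i hi'
        rw [hz i hi' hil'] at h1
        exact zero_ne_one h1

/-- Vectors of form `FormF2` satisfying `RelR2` describe a walk: after its first term it has
`FormF1`, with `x 0, …, x (m-1)` in place of `x 1, …, x m`. -/
theorem exists_seq_of_formF2 {m : ℕ} (hm0 : m ≠ 0) {X Y : W.SingularSubspace k}
    (hm : finrank F ↥(X.1 ⊓ Y.1) + m = k) (hop : X.1 ⊓ W.perp Y.1 ≤ Y.1)
    {S : Fin (m + 2) → Submodule F V} {x y w : ℕ → V}
    (hF : FormF2 W k m X.1 Y.1 S x y w) (hR : RelR2 W m x y) :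
    ∃ g : ℕ → W.SingularSubspace k, (W.polarGrassmannGraph k).Adj X (g 0) ∧ g m = Y ∧
      (∀ i : Fin (m + 1), (g i).1 = S i.succ) ∧
      ∀ i < m, (W.polarGrassmannGraph k).Adj (g i) (g (i + 1)) := by
  obtain ⟨hw, hwr⟩ := isBasisOf_Icc_iff.1 hF.basis_inter
  obtain ⟨hX, hXr⟩ := isBasisOf_joinFamily_iff.1 hF.basis_left
  obtain ⟨U, hUs, hUb⟩ := hF.first_sum
  obtain ⟨hU, hUr⟩ := isBasisOf_joinFamily_iff.1 hUb
  have hYX := W.inf_perp_le_comm X.2.1 (by rw [X.2.2, Y.2.2]) hop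
  set X₀ := Submodule.span F (x '' Ico 0 m) ⊔ Submodule.span F (w '' Icc 1 (k - m)) with hX₀
  have hX₀U : X₀ ≤ U := by
    rw [← hU]
    exact sup_le_sup_right (Submodule.span_mono (image_mono Ico_subset_Icc_self)) _
  have hXU : X.1 ≤ U := by
    rw [← hX, ← hU]
    exact sup_le_sup_right (Submodule.span_mono (image_mono (Icc_subset_Icc_left (by omega)))) _
  have hX₀r : finrank F X₀ = k := by
    have h1 : U ≤ X₀ ⊔ F ∙ x m := by
      rw [← hU]
      refine sup_le (Submodule.span_le.2 ?_) (le_sup_right.trans le_sup_left)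
      rintro _ ⟨i, hi, rfl⟩
      rcases hi.2.lt_or_eq with hlt | rfl
      · exact Submodule.mem_sup_left (Submodule.mem_sup_left
          (Submodule.subset_span ⟨i, ⟨hi.1, hlt⟩, rfl⟩))
      · exact Submodule.mem_sup_right (Submodule.mem_span_singleton_self _)
    have h2 := Submodule.finrank_mono h1
    have h3 := Submodule.finrank_add_le_finrank_add_finrank X₀ (F ∙ x m)
    have h4 : finrank F ↥(F ∙ x m) ≤ 1 := by
      simpa using finrank_span_le_card (R := F) ({x m} : Set V)
    have h5 := Submodule.finrank_add_le_finrank_add_finrank (Submodule.span F (x '' Ico 0 m))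
      (Submodule.span F (w '' Icc 1 (k - m)))
    have h6 := finrank_span_image_Ico_le (F := F) x 0 m
    have h7 : finrank F ↥(Submodule.span F (w '' Icc 1 (k - m))) = k - m := by rw [hw, hwr]
    rw [← hX₀] at h5
    omega
  let X₀' : W.SingularSubspace k := ⟨X₀, hUs.mono hX₀U, hX₀r⟩
  have hsup : X.1 ⊔ X₀ = U := by
    refine le_antisymm (sup_le hXU hX₀U) ?_
    rw [← hU]
    refine sup_le (Submodule.span_le.2 ?_) (le_sup_right.trans le_sup_right)
    rintro _ ⟨i, hi, rfl⟩
    rcases hi.2.lt_or_eq with hlt | rfl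
    · exact Submodule.mem_sup_right (Submodule.mem_sup_left
        (Submodule.subset_span ⟨i, ⟨hi.1, hlt⟩, rfl⟩))
    · rw [← hX]
      exact Submodule.mem_sup_left (Submodule.mem_sup_left
        (Submodule.subset_span ⟨i, ⟨by omega, le_rfl⟩, rfl⟩))
  have hadj : (W.polarGrassmannGraph k).Adj X X₀' := by
    refine ⟨?_, ?_⟩
    · change W.IsSingular (X.1 ⊔ X₀)
      rwa [hsup]
    · change finrank F ↥(X.1 ⊔ X₀) = k + 1
      rw [hsup]
      omega
  have hinf : X₀ ⊓ Y.1 = X.1 ⊓ Y.1 := by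
    refine le_antisymm ?_ (le_inf (hw ▸ le_sup_right) inf_le_right)
    exact le_inf ((le_inf inf_le_right
      (inf_le_left.trans (le_perp_of_adj hadj.symm))).trans hYX) inf_le_right
  have himg : ∀ j, (fun i => x (i - 1)) '' Icc 1 j = x '' Ico 0 j := fun j => by
    ext v
    simp only [mem_image, mem_Icc, mem_Ico]
    constructor
    · rintro ⟨i, hi, rfl⟩
      exact ⟨i - 1, by omega, rfl⟩
    · rintro ⟨i, hi, rfl⟩
      exact ⟨i + 1, by omega, rfl⟩
  have hF1 : FormF1 k m X₀'.1 Y.1 (fun i => S i.succ) (fun i => x (i - 1)) y w := by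
    refine ⟨?_, ?_, hF.basis_right, fun i => ?_⟩
    · change IsBasisOf _ (X₀ ⊓ Y.1)
      rw [hinf]
      exact hF.basis_inter
    · refine isBasisOf_joinFamily_iff.2 ⟨by rw [himg], ?_⟩
      change finrank F X₀ = _
      omega
    · rw [hF.terms i, himg]
  have hone : ∀ i ∈ Icc 1 m, ∀ l ∈ Icc 1 m, W.form (x (i - 1)) (y l) = 1 → i - 1 = l := by
    intro i hi l hl h1
    by_contra hne
    rw [hR.off_diag (i - 1) ⟨by omega, by have := hi.2; omega⟩ l hl hne] at h1
    exact zero_ne_one h1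
  have hR1 : RelR1 W m (fun i => x (i - 1)) y := by
    refine ⟨fun i hi => ?_, fun i hi j hj l hl h1 h2 => ?_⟩
    · have hi1 := hi.1
      have hi2 := hi.2
      rcases Nat.lt_or_ge 1 i with hlt | hle
      · have hmem : i - 1 ∈ Icc 1 m := ⟨by omega, by omega⟩
        exact .inr ⟨i - 1, hmem, by omega, hR.diag _ hmem,
          fun l hl hne => hR.off_diag _ ⟨by omega, hmem.2⟩ l hl hne.symm⟩
      · refine .inl fun l hl => hR.off_diag _ ⟨by omega, by omega⟩ l hl ?_
        have := hl.1
        omega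
    · have h3 := hone i hi l hl h1
      have h4 := hone j hj l hl h2
      have := hl.1
      omega
  obtain ⟨g, hg0, hgm, hgS, hg⟩ := exists_seq_of_formF1 (X := X₀') (Y := Y)
    (show finrank F ↥(X₀ ⊓ Y.1) + m = k by rw [hinf, hm]) hF1 hR1
  exact ⟨g, by rwa [hg0], hgm, hgS, hg⟩

end FormedSpace

namespace FormedSpace

variable {F : Type u} {V : Type v} [Field F] [AddCommGroup V] [Module F V]
  [FiniteDimensional F V] {W : FormedSpace F V} {k : ℕ}

/-! ### Distances and diameter -/

theorem dist_of_not_opposite {m : ℕ} {X Y : W.SingularSubspace k}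
    (hm : finrank F ↥(X.1 ⊓ Y.1) + m = k) (h : m ≠ 0 → ¬ X.1 ⊓ W.perp Y.1 ≤ Y.1) :
    (W.polarGrassmannGraph k).Reachable X Y ∧ (W.polarGrassmannGraph k).dist X Y = m := by
  obtain ⟨p, hp⟩ := exists_walk_of_not_opposite hm h
  refine ⟨p.reachable, le_antisymm (hp ▸ SimpleGraph.dist_le p) ?_⟩
  obtain ⟨q, hq⟩ := p.reachable.exists_walk_length_eq_dist
  have := le_finrank_inf_add_length q
  omega

theorem dist_of_opposite (hk : k < W.wittIndex) {m : ℕ} (hm0 : m ≠ 0)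
    {X Y : W.SingularSubspace k} (hm : finrank F ↥(X.1 ⊓ Y.1) + m = k)
    (h : X.1 ⊓ W.perp Y.1 ≤ Y.1) :
    (W.polarGrassmannGraph k).Reachable X Y ∧ (W.polarGrassmannGraph k).dist X Y = m + 1 := by
  obtain ⟨p, hp⟩ := exists_walk_of_opposite hk hm0 hm h
  refine ⟨p.reachable, le_antisymm (hp ▸ SimpleGraph.dist_le p) ?_⟩
  obtain ⟨q, hq⟩ := p.reachable.exists_walk_length_eq_dist
  have := lt_length_of_opposite hm0 hm h q
  omega

theorem reachable_and_dist_le (hk : k < W.wittIndex) (X Y : W.SingularSubspace k) :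
    (W.polarGrassmannGraph k).Reachable X Y ∧ (W.polarGrassmannGraph k).dist X Y ≤ k + 1 := by
  have hle := (Submodule.finrank_mono (inf_le_left : X.1 ⊓ Y.1 ≤ X.1)).trans_eq X.2.2
  obtain ⟨m, hm⟩ := Nat.exists_eq_add_of_le hle
  by_cases h : m ≠ 0 ∧ X.1 ⊓ W.perp Y.1 ≤ Y.1
  · obtain ⟨h1, h2⟩ := dist_of_opposite hk h.1 hm.symm h.2
    exact ⟨h1, by omega⟩
  · obtain ⟨h1, h2⟩ := dist_of_not_opposite hm.symm fun h0 h' => h ⟨h0, h'⟩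
    exact ⟨h1, by omega⟩

theorem connected_polarGrassmannGraph (hk : k < W.wittIndex) :
    (W.polarGrassmannGraph k).Connected := by
  obtain ⟨X, hX, hXk⟩ := W.exists_isSingular_finrank_eq hk.le
  have : Nonempty (W.SingularSubspace k) := ⟨⟨X, hX, hXk⟩⟩
  exact ⟨fun X Y => (reachable_and_dist_le hk X Y).1⟩

theorem diam_polarGrassmannGraph (hk0 : 1 ≤ k) (hk : k < W.wittIndex) :
    (W.polarGrassmannGraph k).diam = k + 1 := by
  have hle : (W.polarGrassmannGraph k).ediam ≤ ((k + 1 : ℕ) : ℕ∞) := by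
    refine SimpleGraph.ediam_le_of_edist_le fun X Y => ?_
    obtain ⟨h1, h2⟩ := reachable_and_dist_le hk X Y
    rw [← h1.coe_dist_eq_edist]
    exact_mod_cast h2
  have htop : (W.polarGrassmannGraph k).ediam ≠ ⊤ := ne_top_of_le_ne_top (ENat.natCast_ne_top _) hle
  refine le_antisymm ?_ ?_
  · exact ENat.toNat_le_of_le_natCast hle
  · obtain ⟨X, hX, hXk⟩ := W.exists_isSingular_finrank_eq hk.le
    obtain ⟨Y, hY, hYk, hXY⟩ := W.exists_isSingular_inf_perp_eq_bot hX
    have hinf : X ⊓ Y = ⊥ := eq_bot_iff.2 (hXY ▸ inf_le_inf_left X hY.1)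
    have hd := (dist_of_opposite hk (m := k) (by omega) (X := ⟨X, hX, hXk⟩)
      (Y := ⟨Y, hY, hYk.trans hXk⟩) (show finrank F ↥(X ⊓ Y) + k = k by
        rw [hinf, finrank_bot, zero_add]) (show X ⊓ W.perp Y ≤ Y from hXY ▸ bot_le)).2
    rw [← hd]
    exact SimpleGraph.dist_le_diam htop

end FormedSpace

theorem proposition4p1 {F : Type*} {V : Type*} [Field F] [Finite F] [AddCommGroup V] [Module F V]
    [FiniteDimensional F V] (W : FormedSpace F V) (k : ℕ) (hk : 1 ≤ k) (hkω : k < W.wittIndex) :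
    (∀ X Y : W.SingularSubspace k, X ≠ Y →
      -- non-opposite pairs: distance, and the geodesics are exactly those of form (F1), (R1)
      (¬ W.Opposite X.1 Y.1 → ∀ m : ℕ, m = k - finrank F ↥(X.1 ⊓ Y.1) →
        (W.polarGrassmannGraph k).Reachable X Y ∧
        (W.polarGrassmannGraph k).dist X Y = m ∧
        (∀ L : Fin (m + 1) → W.SingularSubspace k,
          IsGeodesic (W.polarGrassmannGraph k) X Y m L →
            ∃ x y w : ℕ → V, FormF1 k m X.1 Y.1 (fun i => (L i).1) x y w ∧ RelR1 W m x y) ∧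
        (∀ (S : Fin (m + 1) → Submodule F V) (x y w : ℕ → V),
          FormF1 k m X.1 Y.1 S x y w → RelR1 W m x y →
            ∃ L : Fin (m + 1) → W.SingularSubspace k, (∀ i, (L i).1 = S i) ∧
              IsGeodesic (W.polarGrassmannGraph k) X Y m L)) ∧
      -- opposite pairs: distance, and the geodesics are exactly those of form (F2), (R2)
      (W.Opposite X.1 Y.1 → ∀ m : ℕ, m = k - finrank F ↥(X.1 ⊓ Y.1) →
        (W.polarGrassmannGraph k).Reachable X Y ∧
        (W.polarGrassmannGraph k).dist X Y = m + 1 ∧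
        (∀ L : Fin (m + 2) → W.SingularSubspace k,
          IsGeodesic (W.polarGrassmannGraph k) X Y (m + 1) L →
            ∃ x y w : ℕ → V, FormF2 W k m X.1 Y.1 (fun i => (L i).1) x y w ∧ RelR2 W m x y) ∧
        (∀ (S : Fin (m + 2) → Submodule F V) (x y w : ℕ → V),
          FormF2 W k m X.1 Y.1 S x y w → RelR2 W m x y →
            ∃ L : Fin (m + 2) → W.SingularSubspace k, (∀ i, (L i).1 = S i) ∧
              IsGeodesic (W.polarGrassmannGraph k) X Y (m + 1) L))) ∧
    -- the diameter
    (W.polarGrassmannGraph k).Connected ∧ (W.polarGrassmannGraph k).diam = k + 1 := by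
  refine ⟨fun X Y hXY => ?_, FormedSpace.connected_polarGrassmannGraph hkω,
    FormedSpace.diam_polarGrassmannGraph hk hkω⟩
  have hrk : finrank F X.1 = finrank F Y.1 := by rw [X.2.2, Y.2.2]
  rw [W.opposite_iff X.2.1 Y.2.1 hrk]
  have hle := (Submodule.finrank_mono (inf_le_left : X.1 ⊓ Y.1 ≤ X.1)).trans_eq X.2.2
  refine ⟨fun hop m hmk => ?_, fun hop m hmk => ?_⟩
  all_goals
    have hm : finrank F ↥(X.1 ⊓ Y.1) + m = k := by omega
    have hm0 : m ≠ 0 := fun h0 => hXY (FormedSpace.eq_of_finrank_inf_eq (by omega))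
  · obtain ⟨hreach, hdist⟩ := FormedSpace.dist_of_not_opposite hm fun _ => hop
    refine ⟨hreach, hdist, fun L hL => ?_, fun S x y w hF hR => ?_⟩
    · obtain ⟨f, rfl, rfl, hf, hfL⟩ := hL.exists_seq
      simp only [← hfL]
      exact FormedSpace.exists_formF1_of_seq hf hm
    · obtain ⟨f, rfl, rfl, hS, hf⟩ := FormedSpace.exists_seq_of_formF1 hm hF hR
      exact ⟨fun i => f i, hS, isGeodesic_of_seq hf hdist⟩
  · obtain ⟨hreach, hdist⟩ := FormedSpace.dist_of_opposite hkω hm0 hm hop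
    refine ⟨hreach, hdist, fun L hL => ?_, fun S x y w hF hR => ?_⟩
    · obtain ⟨f, rfl, rfl, hf, hfL⟩ := hL.exists_seq
      exact FormedSpace.exists_formF2_of_seq (g := fun i => f (i + 1)) hm0 (hf 0 (by omega))
        (fun i hi => hf (i + 1) (by omega)) hm hop (by rw [← hfL]; rfl)
        (fun i => by rw [← hfL]; rfl)
    · obtain ⟨g, hadj, rfl, hS, hg⟩ := FormedSpace.exists_seq_of_formF2 hm0 hm hop hF hR
      let f : ℕ → W.SingularSubspace k := fun n => Nat.casesOn n X g
      have hf : ∀ i < m + 1, (W.polarGrassmannGraph k).Adj (f i) (f (i + 1)) := fun i hi => by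
        cases i with
        | zero => exact hadj
        | succ i => exact hg i (by omega)
      refine ⟨fun i => f i, fun i => ?_, isGeodesic_of_seq (f := f) hf hdist⟩
      induction i using Fin.cases with
      | zero => exact hF.first.symm
      | succ i => exact hS i
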